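/- For $N\ge 0$ let $\Lambda_N$ be the $N\times N$ square lattice with free boundary, let $n=N^2$ be the number of its sites, put a qubit on every site, and let $$H_N=-\sum_{\langle i,j\rangle} Z_iZ_j ,$$ the sum being over unordered pairs of nearest-neighbour sites of $\Lambda_N$ (the classical 2D Ising model). For $\beta>0$ let $\rho_\beta=e^{-\beta H_N}/\operatorname{Tr}e^{-\beta H_N}$. *The Gibbs sampler.* For a Hamiltonian $H$, jump operators $(A_a)_{a=1}^J$ and $\beta>0$, write $X(t)=e^{iHt}Xe^{-iHt}$. The Gibbs sampler of Chen, Kastoryano and Gilyén is the Lindbladian $$\mathcal L(\rho)=-i[B,\rho]+\sum_{a=1}^J\int_{-\infty}^\infty \gamma(\omega)\Big(\hat A_a(\omega)\rho\hat A_a(\omega)^\dagger-\tfrac12\big\{\hat A_a(\omega)^\dagger\hat A_a(\omega),\rho\big\}\Big)d\omega,$$ where $\gamma(\omega)=e^{-(\beta\omega+1)^2/2}$, $$\hat A_a(\omega)=\frac1{\sqrt{2\pi}}\int_{-\infty}^\infty e^{-i\omega t}f(t)A_a(t)\,dt,\qquad f(t)=\Big(\tfrac1\beta\sqrt{2/\pi}\Big)^{1/2}e^{-t^2/\beta^2},$$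 $$B=\sum_{a=1}^J\int_{-\infty}^\infty b_1(t)\Big(\int_{-\infty}^\infty b_2(t')\,A_a^\dagger(\beta t')A_a(-\beta t')\,dt'\Big)(-\beta t)\,dt,$$ $$b_1(t)=\int_{-\infty}^\infty\frac{\sin(s-t)\,e^{-2(s-t)^2}}{\cosh(2\pi s)}\,ds,\qquad b_2(t')=\frac{2e^{1/8}}{\pi}e^{-4t'^2-2it'} .$$ *Mixing time.* For $0<\epsilon\le\frac12$, $T_{\rm mix}(\mathcal L)\in[0,\infty]$ is the infimum of the times $t\ge0$ with $\|e^{t\mathcal L}(\rho-\sigma)\|_1\le\epsilon\|\rho-\sigma\|_1$ for all density matrices $\rho,\sigma$. **Statement.** There is a constant $\beta_*>0$ such that for all $\beta\ge\beta_*$ the following holds. Let $k$ be a constant and, for every $N$, let $(A_{N,a})_{a=1}^{J(N)}$ be jump operators on the qubits of $\Lambda_N$ such that each acts nontrivially on at most $k$ qubits and has operator norm at most $1$, the family is closed under adjoints (there is a permutation $\tau$ of the indices with $A_{N,\tau(a)}=A_{N,a}^\dagger$), and $J(N)=O(n^p)$ for some $p$. Let $\mathcal L_N$ be the Gibbs sampler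 for $H_N$, $\beta$ and these jump operators. Then $\mathcal L_N$ has the Gibbs state as a fixed point, $\mathcal L_N(\rho_\beta)=0$, for every $N$, and it has superpolynomial mixing time: for every constant $0<\epsilon\le\frac12$ and every $d$, $T_{\rm mix}(\mathcal L_N)\ge n^d$ for all sufficiently large $N$. -/

import Mathlib

open scoped Matrix ComplexOrder Matrix.Norms.L2Operator ENNReal NNReal
open MeasureTheory Filter

noncomputable section

namespace GibbsSampling

/-! ### Qubits: operators and superoperators

For a finite set `V` of qubits the computational basis is `V → Fin 2`. The norm on operators is the
operator norm induced by the Hilbert space norm. -/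

/-- Linear operators on the Hilbert space of the qubits in `V`, in the computational basis. -/
abbrev Op (V : Type) := Matrix (V → Fin 2) (V → Fin 2) ℂ

/-- Superoperators: (automatically continuous) linear maps from operators to operators, with
composition as multiplication. -/
def SuperOp (V : Type) [Fintype V] [DecidableEq V] := Op V →L[ℂ] Op V

instance (V : Type) [Fintype V] [DecidableEq V] : NormedRing (SuperOp V) :=
  inferInstanceAs (NormedRing (Op V →L[ℂ] Op V))

instance (V : Type) [Fintype V] [DecidableEq V] : NormedAlgebra ℂ (SuperOp V) :=
  inferInstanceAs (NormedAlgebra ℂ (Op V →L[ℂ] Op V))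

instance (V : Type) [Fintype V] [DecidableEq V] : CompleteSpace (SuperOp V) :=
  inferInstanceAs (CompleteSpace (Op V →L[ℂ] Op V))

instance (V : Type) [Fintype V] [DecidableEq V] : FunLike (SuperOp V) (Op V) (Op V) :=
  inferInstanceAs (FunLike (Op V →L[ℂ] Op V) (Op V) (Op V))

section General

variable {V : Type} [Fintype V] [DecidableEq V]

namespace SuperOp

@[simp] theorem add_apply (S T : SuperOp V) (X : Op V) : (S + T) X = S X + T X := rfl

@[simp] theorem sub_apply (S T : SuperOp V) (X : Op V) : (S - T) X = S X - T X := rfl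

@[simp] theorem smul_apply (c : ℂ) (S : SuperOp V) (X : Op V) : (c • S) X = c • S X := rfl

@[simp] theorem mul_apply (S T : SuperOp V) (X : Op V) : (S * T) X = S (T X) := rfl

@[simp] theorem one_apply (X : Op V) : (1 : SuperOp V) X = X := rfl

end SuperOp

/-- The superoperator `X ↦ A X`. -/
def leftMul (A : Op V) : SuperOp V := ContinuousLinearMap.mul ℂ (Op V) A

/-- The superoperator `X ↦ X A`. -/
def rightMul (A : Op V) : SuperOp V := (ContinuousLinearMap.mul ℂ (Op V)).flip A

@[simp] theorem leftMul_apply (A X : Op V) : leftMul A X = A * X := rfl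

@[simp] theorem rightMul_apply (A X : Op V) : rightMul A X = X * A := rfl

/-- The Pauli operator `Z` on the qubit `i`, tensored with the identity on the other qubits. -/
def pauliZ (i : V) : Op V := Matrix.diagonal fun x => if x i = 0 then 1 else -1

/-- `A` acts nontrivially only on the qubits in `S`: it is `M ⊗ I` with `M` acting on `S`. -/
def SupportedOn (S : Finset V) (A : Op V) : Prop :=
  ∃ M : Matrix (S → Fin 2) (S → Fin 2) ℂ, ∀ x y : V → Fin 2,
    A x y = if ∀ i, i ∉ S → x i = y i then M (fun i => x i) (fun i => y i) else 0

/-- `A` acts nontrivially on at most `k` qubits (no geometric restriction). -/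
def IsLocalOp (k : ℕ) (A : Op V) : Prop := ∃ S : Finset V, S.card ≤ k ∧ SupportedOn S A

/-- Density matrices. -/
def IsState (ρ : Op V) : Prop := ρ.PosSemidef ∧ ρ.trace = 1

/-- The trace norm: the sum of the singular values. -/
def traceNorm (X : Op V) : ℝ :=
  ∑ i, Real.sqrt ((Matrix.isHermitian_conjTranspose_mul_self X).eigenvalues i)

/-- The Gibbs state of the Hamiltonian `H` at inverse temperature `β`. -/
def gibbsState (H : Op V) (β : ℝ) : Op V :=
  (NormedSpace.exp ((-β : ℂ) • H)).trace⁻¹ • NormedSpace.exp ((-β : ℂ) • H)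

/-! ### Mixing time -/

/-- The mixing time at accuracy `ε` of the semigroup generated by `𝓛`: the least time `t ≥ 0` for
which `‖exp (t 𝓛) (ρ - σ)‖₁ ≤ ε ‖ρ - σ‖₁` for all states `ρ`, `σ`; it is `∞` if there is none. -/
def mixingTime (ε : ℝ) (𝓛 : SuperOp V) : ℝ≥0∞ :=
  ⨅ (t : ℝ≥0) (_ : ∀ ρ σ : Op V, IsState ρ → IsState σ →
    traceNorm (NormedSpace.exp (((t : ℝ) : ℂ) • 𝓛) (ρ - σ)) ≤ ε * traceNorm (ρ - σ)), (t : ℝ≥0∞)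

/-! ### The Gibbs sampler of Chen, Kastoryano and Gilyén -/

/-- The time evolution `exp (i t H) A exp (-i t H)`. -/
def evolve (H A : Op V) (t : ℝ) : Op V :=
  NormedSpace.exp ((Complex.I * t) • H) * A * NormedSpace.exp ((-(Complex.I * t)) • H)

/-- The superoperator `ρ ↦ [G, ρ]`. -/
def commutator (G : Op V) : SuperOp V := leftMul G - rightMul G

@[simp] theorem commutator_apply (G ρ : Op V) : commutator G ρ = G * ρ - ρ * G := rfl

/-- The superoperator `ρ ↦ K ρ K† - ½ {K† K, ρ}`. -/
def dissipator (K : Op V) : SuperOp V :=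
  leftMul K * rightMul Kᴴ - (1 / 2 : ℂ) • (leftMul (Kᴴ * K) + rightMul (Kᴴ * K))

@[simp] theorem dissipator_apply (K ρ : Op V) :
    dissipator K ρ = K * ρ * Kᴴ - (1 / 2 : ℂ) • (Kᴴ * K * ρ + ρ * (Kᴴ * K)) := by
  simp [dissipator, mul_assoc]

/-- The Gaussian filter in time; `∫ |gaussianFilter β t|² dt = 1`. -/
def gaussianFilter (β t : ℝ) : ℝ := Real.sqrt (Real.sqrt (2 / Real.pi) / β) * Real.exp (-(t ^ 2 / β ^ 2))

/-- The Gaussian transition weight. -/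
def transitionWeight (β ω : ℝ) : ℝ := Real.exp (-((β * ω + 1) ^ 2 / 2))

/-- The operator Fourier transform `Â(ω)` of the jump operator `A`:
`(2π)^(-1/2) ∫ e^(-iωt) f(t) exp (i t H) A exp (-i t H) dt`. -/
def fourierJump (β : ℝ) (H A : Op V) (ω : ℝ) : Op V :=
  ((Real.sqrt (2 * Real.pi))⁻¹ : ℂ) •
    ∫ t : ℝ, (Complex.exp (-(Complex.I * ω * t)) * gaussianFilter β t) • evolve H A t

/-- The outer time weight of the coherent term. -/
def coherentWeight₁ (t : ℝ) : ℝ :=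
  ∫ s : ℝ, Real.sin (s - t) * Real.exp (-2 * (s - t) ^ 2) / Real.cosh (2 * Real.pi * s)

/-- The inner time weight of the coherent term. -/
def coherentWeight₂ (t : ℝ) : ℂ :=
  2 * Real.exp (1 / 8) / Real.pi * Complex.exp (-4 * t ^ 2 - 2 * Complex.I * t)

/-- The contribution of the jump operator `A` to the coherent term: with `X(t)` denoting
`exp (i t H) X exp (-i t H)`, it is `∫ b₁(t) (∫ b₂(t') A†(βt') A(-βt') dt')(-βt) dt`. -/
def coherentTerm (β : ℝ) (H A : Op V) : Op V :=
  ∫ t : ℝ, (coherentWeight₁ t : ℂ) •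
    evolve H (∫ t' : ℝ, coherentWeight₂ t' • (evolve H Aᴴ (β * t') * evolve H A (-(β * t'))))
      (-(β * t))

/-- The Lindbladian of the Gibbs sampler at inverse temperature `β` for the Hamiltonian `H` and
the jump operators `A a`:
`ρ ↦ -i [B, ρ] + ∑ a, ∫ γ(ω) (Â_a(ω) ρ Â_a(ω)† - ½ {Â_a(ω)† Â_a(ω), ρ}) dω`. -/
def gibbsSampler {J : ℕ} (β : ℝ) (H : Op V) (A : Fin J → Op V) : SuperOp V :=
  (-Complex.I) • commutator (∑ a, coherentTerm β H (A a))
    + ∑ a, ∫ ω : ℝ, (transitionWeight β ω : ℂ) • dissipator (fourierJump β H (A a) ω)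

/-- A family of jump operators that is closed under the adjoint, as an indexed family. -/
def AdjointClosed {J : ℕ} (A : Fin J → Op V) : Prop :=
  ∃ τ : Equiv.Perm (Fin J), ∀ a, A (τ a) = (A a)ᴴ

end General

/-! ### The classical two-dimensional Ising model -/

/-- The sites `(r, c)` of the `N × N` square lattice, with free boundary. -/
abbrev Site (N : ℕ) := Fin N × Fin N

/-- `q` is the nearest neighbor of `p` to the right or below, so that each unordered pair of
neighboring sites is counted exactly once. -/
def IsBond {N : ℕ} (p q : Site N) : Prop :=
  (p.1 = q.1 ∧ p.2.val + 1 = q.2.val) ∨ (p.2 = q.2 ∧ p.1.val + 1 = q.1.val)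

instance {N : ℕ} (p q : Site N) : Decidable (IsBond p q) :=
  inferInstanceAs (Decidable (_ ∨ _))

/-- The Hamiltonian `-∑ Z_i Z_j`, the sum being over unordered pairs of neighboring sites. -/
def ising2D (N : ℕ) : Op (Site N) :=
  -∑ p : Site N, ∑ q : Site N, if IsBond p q then pauliZ p * pauliZ q else 0

end GibbsSampling

end

/-!
The proof has three ingredients.

**The Gibbs state is a fixed point.** The Ising Hamiltonian is diagonal in the computational basis,
so every integral in the definition of the Gibbs sampler can be evaluated entry by entry, and only
the values of the energy at basis states matter. For a diagonal operator with entries `p`, the entry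
`(x, y)` of its image under the sampler is a sum over intermediate basis states `z` of products
`A x z * star (A y z)` and `star (A z x) * A z y`, whose coefficients are functions of the Bohr
frequencies (`gibbsSampler_diagonal_apply`). The coefficient of the dissipative part is a Gaussian
integral, `kossakowski`; it obeys the detailed balance relation `kossakowski_neg`. The coefficient
of the coherent part is a product of a Gaussian and a hyperbolic tangent: the latter comes from the
Fourier transforms of `sin u * exp (-2 u²)` and of the hyperbolic secant, whose convolution is
`coherentWeight₁`. Since the family of jump operators is closed under adjoints, the two kinds of
products can be reindexed into each other, and for Gibbs weights the coefficients cancel because of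
the identity `tanh_mul_exp_sub_exp`. The result is `gibbsSampler_gibbsState`.

**A bottleneck.** Let `s` be the magnetization of the first row of the lattice. A jump operator that
acts on `k` qubits changes `s` by at most `κ = 2 * k`. Hence, if the Gibbs state is cut into its
parts on `s > 2 * κ`, on `s < -2 * κ` and on `|s| ≤ 2 * κ`, the sampler maps the first part to minus
the block on `s > 0` of the image of the third part (`gibbsSampler_restrictedDiagonal`). So the flow
of probability between the first two parts is at most the weight of the third part times a rate that
is proportional to the number of jump operators. In the Heisenberg picture the semigroup is
contractive in the operator norm: the generator is dissipative, which is tested on the singular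
vectors of an observable (`isDissipative_gibbsSampler`, `IsDissipative.norm_exp_heisenberg_le`). The
bound on the flow therefore persists at all times. The global spin flip exchanges the first two
parts, so that their normalizations are states at trace distance `2`, and a time that halves this
distance is at least of the order of the inverse of the flow (`one_le_of_halved`). Observables are
compared with the trace norm by Hölder's inequality, `norm_trace_mul_le_mul_traceNorm`.

**The weight of the bottleneck.** The unsatisfied bonds of a configuration are dual to its Peierls
contours. Let the row contours be the clusters of unsatisfied bonds that touch the bonds of the
first row. Around every plaquette they have an even number of bonds, so they can be erased by
flipping spins (`exists_unsat_eq_rowContours`, from the vanishing of the first cohomology of the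
square, `exists_potential`). After that the first row is constant. Thus, if the first row is nearly
balanced, then it is nearly balanced in the configuration that has the row contours as its only
unsatisfied bonds, and an isoperimetric inequality provides about `N / 2` row contour bonds
(`le_abs_rowSum_add_card_unsat`). The number of possible sets of row contours is controlled by a
generating function, `sum_clusters_le_one`: in a uniformly random set of bonds the cluster of the
first row takes a given value with a probability that is at least exponentially small in the sizes of
that value and of the first row, and these probabilities sum to at most one. For `β ≥ 9` the energy
outweighs this entropy, and the bottleneck has relative weight at most `exp (8 * k - N)`
(`sum_exp_balanced_le`). This beats every power of `N`.
-/

noncomputable section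

namespace GibbsSampling

/-! ### Fourier transforms of the filter functions -/

/-- The Gaussian integral with a complex linear term and a real quadratic term. -/
theorem integral_cexp_neg_sq_add_linear {b : ℝ} (hb : 0 < b) (c d : ℂ) :
    ∫ x : ℝ, Complex.exp (-b * x ^ 2 + c * x + d)
      = Real.sqrt (Real.pi / b) * Complex.exp (d + c ^ 2 / (4 * b)) := by
  have h := integral_cexp_quadratic (b := -(b : ℂ)) (by simpa using hb) c d
  rw [h, neg_neg, Real.sqrt_eq_rpow, Complex.ofReal_cpow (by positivity)]
  push_cast
  congr 2
  rw [mul_neg, div_neg, sub_neg_eq_add]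

theorem integrable_cexp_neg_sq_add_linear {b : ℝ} (hb : 0 < b) (c d : ℂ) :
    Integrable fun x : ℝ => Complex.exp (-b * x ^ 2 + c * x + d) :=
  integrable_cexp_quadratic (b := (b : ℂ)) (by simpa using hb) c d

/-- Euler's reflection formula for `Γ(1/2 + iy) Γ(1/2 - iy)`, read as an integral over the real
line after the substitution `x = sigmoid v` in the beta integral. -/
theorem integral_cexp_div_two_cosh (y : ℝ) :
    ∫ v : ℝ, Complex.exp (Complex.I * y * v) / ((2 * Real.cosh (v / 2) : ℝ) : ℂ)
      = Real.pi / Real.cosh (Real.pi * y) := by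
  have hre₁ : 0 < (1 / 2 + Complex.I * y : ℂ).re := by simp
  have hre₂ : 0 < (1 / 2 - Complex.I * y : ℂ).re := by simp
  have hbeta := Complex.Gamma_mul_Gamma_eq_betaIntegral hre₁ hre₂
  have hsum : (1 / 2 + Complex.I * y : ℂ) + (1 / 2 - Complex.I * y) = 1 := by ring
  have hone : (1 / 2 - Complex.I * y : ℂ) = 1 - (1 / 2 + Complex.I * y) := by ring
  rw [hsum, Complex.Gamma_one, one_mul] at hbeta
  have hrefl : Complex.betaIntegral (1 / 2 + Complex.I * y) (1 / 2 - Complex.I * y)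
      = Real.pi / Real.cosh (Real.pi * y) := by
    rw [← hbeta]
    conv_lhs => rw [hone]
    rw [Complex.Gamma_mul_Gamma_one_sub]
    congr 1
    rw [show (Real.pi : ℂ) * (1 / 2 + Complex.I * y)
      = (Real.pi : ℂ) * y * Complex.I + Real.pi / 2 by ring, Complex.sin_add_pi_div_two,
      Complex.cos_mul_I]
    push_cast
    rfl
  rw [← hrefl, Complex.betaIntegral, intervalIntegral.integral_of_le zero_le_one,
    integral_Ioc_eq_integral_Ioo, ← Real.range_sigmoid, ← Set.image_univ,
    integral_image_eq_integral_abs_deriv_smul MeasurableSet.univ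
      (fun x _ => (Real.hasDerivAt_sigmoid x).hasDerivWithinAt) Real.sigmoid_injective.injOn,
    setIntegral_univ]
  congr 1
  ext v
  have hc : 0 < 2 * Real.cosh (v / 2) := by positivity
  have hs : Real.sigmoid v = Real.exp (v / 2 - Real.log (2 * Real.cosh (v / 2))) := by
    rw [Real.exp_sub, Real.exp_log hc, Real.sigmoid_def, Real.cosh_eq,
      show -v = -(v / 2) + -(v / 2) by ring, Real.exp_add, Real.exp_neg]
    have := Real.exp_pos (v / 2)
    field_simp
  have hs' : 1 - Real.sigmoid v = Real.exp (-(v / 2) - Real.log (2 * Real.cosh (v / 2))) := by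
    rw [← Real.sigmoid_neg, Real.exp_sub, Real.exp_log hc, Real.sigmoid_def, Real.cosh_eq, neg_neg,
      show Real.exp v = Real.exp (v / 2) * Real.exp (v / 2) by rw [← Real.exp_add]; ring_nf,
      Real.exp_neg]
    have := Real.exp_pos (v / 2)
    field_simp
    ring
  have h1 := Real.sigmoid_pos v
  have h2 : 0 < 1 - Real.sigmoid v := by linarith [Real.sigmoid_lt_one v]
  have hc' : ((2 * Real.cosh (v / 2) : ℝ) : ℂ)
      = Complex.exp (Real.log (2 * Real.cosh (v / 2)) : ℝ) := by
    rw [← Complex.ofReal_exp, Real.exp_log hc]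
  rw [abs_of_pos (mul_pos h1 h2), ← Complex.ofReal_one, ← Complex.ofReal_sub, hs', hs, hc',
    Complex.real_smul, Complex.cpow_def_of_ne_zero (by exact_mod_cast (Real.exp_pos _).ne'),
    Complex.cpow_def_of_ne_zero (by exact_mod_cast (Real.exp_pos _).ne'), ← Complex.ofReal_log
    (Real.exp_pos _).le, ← Complex.ofReal_log (Real.exp_pos _).le, Real.log_exp, Real.log_exp]
  push_cast
  rw [← Complex.exp_add, ← Complex.exp_add, ← Complex.exp_add, ← Complex.exp_sub]
  congr 1
  ring

/-- The Fourier transform of the hyperbolic secant. -/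
theorem integral_cexp_mul_inv_cosh (δ : ℝ) :
    ∫ s : ℝ, Complex.exp (-(Complex.I * δ * s)) * ((Real.cosh (2 * Real.pi * s))⁻¹ : ℝ)
      = ((1 / (2 * Real.cosh (δ / 4)) : ℝ) : ℂ) := by
  have hpi := Real.pi_pos
  have h := integral_cexp_div_two_cosh (-(δ / (4 * Real.pi)))
  have hcv := Measure.integral_comp_mul_left (fun v : ℝ => Complex.exp (Complex.I *
    (-(δ / (4 * Real.pi)) : ℝ) * v) / ((2 * Real.cosh (v / 2) : ℝ) : ℂ)) (4 * Real.pi)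
  rw [h, abs_of_pos (by positivity)] at hcv
  have hfun : ∀ s : ℝ, Complex.exp (-(Complex.I * δ * s)) * ((Real.cosh (2 * Real.pi * s))⁻¹ : ℝ)
      = 2 * (Complex.exp (Complex.I * (-(δ / (4 * Real.pi)) : ℝ) * (4 * Real.pi * s : ℝ))
        / ((2 * Real.cosh (4 * Real.pi * s / 2) : ℝ) : ℂ)) := by
    intro s
    have hpi' : (Real.pi : ℂ) ≠ 0 := by exact_mod_cast hpi.ne'
    have hc : (Real.cosh (2 * Real.pi * s) : ℂ) ≠ 0 := by
      exact_mod_cast (Real.cosh_pos _).ne'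
    rw [show 4 * Real.pi * s / 2 = 2 * Real.pi * s by ring,
      show Complex.I * (-(δ / (4 * Real.pi)) : ℝ) * (4 * Real.pi * s : ℝ)
        = -(Complex.I * δ * s) by push_cast; field_simp]
    rw [Complex.ofReal_inv, Complex.ofReal_mul]
    push_cast at hc ⊢
    field_simp
  simp_rw [hfun]
  rw [integral_const_mul, hcv, show Real.pi * -(δ / (4 * Real.pi)) = -(δ / 4) by field_simp,
    Real.cosh_neg, Complex.real_smul]
  have hpi' : (Real.pi : ℂ) ≠ 0 := by exact_mod_cast hpi.ne'
  have hc : (Real.cosh (δ / 4) : ℂ) ≠ 0 := by exact_mod_cast (Real.cosh_pos _).ne'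
  push_cast at hc ⊢
  field_simp
  norm_num

theorem integrable_inv_cosh : Integrable fun s : ℝ => (Real.cosh (2 * Real.pi * s))⁻¹ := by
  by_contra H
  have H' : ¬ Integrable fun s : ℝ => ((Real.cosh (2 * Real.pi * s))⁻¹ : ℝ) := H
  have h := integral_cexp_mul_inv_cosh 0
  simp only [Complex.ofReal_zero, mul_zero, zero_mul, neg_zero, Complex.exp_zero, one_mul,
    integral_complex_ofReal, integral_undef H'] at h
  norm_num at h

/-- The Fourier transform of `u ↦ sin u * exp (-2 u²)`. -/
theorem integral_cexp_mul_sin_mul_gaussian (δ : ℝ) :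
    ∫ u : ℝ, Complex.exp (-(Complex.I * δ * u)) *
        ((Real.sin u * Real.exp (-2 * u ^ 2) : ℝ) : ℂ)
      = -Complex.I * Real.sqrt (Real.pi / 2) * Real.exp (-1 / 8) * Real.exp (-δ ^ 2 / 8)
        * Real.sinh (δ / 4) := by
  have hfun : ∀ u : ℝ, Complex.exp (-(Complex.I * δ * u)) *
        ((Real.sin u * Real.exp (-2 * u ^ 2) : ℝ) : ℂ)
      = (-Complex.I / 2) * (Complex.exp (-(2 : ℝ) * u ^ 2 + (Complex.I * (1 - δ)) * u + 0)
        - Complex.exp (-(2 : ℝ) * u ^ 2 + (-Complex.I * (1 + δ)) * u + 0)) := by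
    intro u
    push_cast
    rw [Complex.sin, show -(2 : ℂ) * u ^ 2 + (Complex.I * (1 - δ)) * u + 0
        = -(Complex.I * δ * u) + u * Complex.I + -2 * u ^ 2 by ring,
      show -(2 : ℂ) * u ^ 2 + (-Complex.I * (1 + δ)) * u + 0
        = -(Complex.I * δ * u) + -u * Complex.I + -2 * u ^ 2 by ring, Complex.exp_add,
      Complex.exp_add, Complex.exp_add, Complex.exp_add]
    ring
  simp_rw [hfun]
  rw [integral_const_mul, integral_sub (integrable_cexp_neg_sq_add_linear two_pos _ _)
    (integrable_cexp_neg_sq_add_linear two_pos _ _), integral_cexp_neg_sq_add_linear two_pos,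
    integral_cexp_neg_sq_add_linear two_pos]
  have e1 : (0 : ℂ) + (Complex.I * (1 - δ)) ^ 2 / (4 * (2 : ℝ)) = -1 / 8 + -δ ^ 2 / 8 + δ / 4 := by
    rw [mul_pow, Complex.I_sq]; push_cast; ring
  have e2 : (0 : ℂ) + (-Complex.I * (1 + δ)) ^ 2 / (4 * (2 : ℝ))
      = -1 / 8 + -δ ^ 2 / 8 + -(δ / 4) := by
    rw [mul_pow, neg_sq, Complex.I_sq]; push_cast; ring
  rw [e1, e2, Complex.exp_add, Complex.exp_add, Complex.exp_add, Complex.exp_add]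
  push_cast
  rw [Complex.sinh]
  ring

theorem integrable_sin_mul_gaussian :
    Integrable fun u : ℝ => Real.sin u * Real.exp (-2 * u ^ 2) :=
  (integrable_exp_neg_mul_sq (b := 2) two_pos).bdd_mul
    Real.continuous_sin.aestronglyMeasurable (c := 1)
    (Eventually.of_forall fun x => by simpa using Real.abs_sin_le_one x)

/-- Multiplying an integrable function by a plane wave does not affect integrability. -/
theorem Integrable.cexp_I_mul {f : ℝ → ℂ} (hf : Integrable f) (δ : ℝ) :
    Integrable fun t : ℝ => Complex.exp (-(Complex.I * δ * t)) * f t := by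
  refine hf.bdd_mul (c := 1) (Continuous.aestronglyMeasurable (by fun_prop))
    (Eventually.of_forall fun t => ?_)
  rw [show -(Complex.I * δ * t) = ((-(δ * t) : ℝ) : ℂ) * Complex.I by push_cast; ring,
    Complex.norm_exp_ofReal_mul_I]

theorem coherentWeight₁_mul_cexp (δ t : ℝ) :
    Complex.exp (-(Complex.I * δ * t)) * coherentWeight₁ t
      = convolution
          (fun s : ℝ => Complex.exp (-(Complex.I * δ * s)) * ((Real.cosh (2 * Real.pi * s))⁻¹ : ℝ))
          (fun u : ℝ => Complex.exp (-(Complex.I * δ * u)) *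
            ((-(Real.sin u * Real.exp (-2 * u ^ 2)) : ℝ) : ℂ))
          (ContinuousLinearMap.mul ℝ ℂ) volume t := by
  rw [convolution_def, coherentWeight₁, ← integral_complex_ofReal, ← integral_const_mul]
  congr 1
  ext s
  have h : Complex.exp (-(Complex.I * δ * t))
      = Complex.exp (-(Complex.I * δ * s)) * Complex.exp (-(Complex.I * δ * (t - s : ℝ))) := by
    rw [← Complex.exp_add]; push_cast; ring_nf
  have h' : Real.sin (s - t) = -Real.sin (t - s) := by rw [← Real.sin_neg, neg_sub]
  rw [ContinuousLinearMap.mul_apply', h, h', show (s - t) ^ 2 = (t - s) ^ 2 by ring]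
  push_cast
  ring

theorem integrable_coherentWeight₁ : Integrable coherentWeight₁ := by
  have h := Integrable.integrable_convolution (ContinuousLinearMap.mul ℝ ℂ)
    (Integrable.cexp_I_mul integrable_inv_cosh.ofReal 0)
    (Integrable.cexp_I_mul integrable_sin_mul_gaussian.neg.ofReal 0)
  have h' : Integrable fun t : ℝ => (coherentWeight₁ t : ℂ) := by
    refine h.congr (Eventually.of_forall fun t => ?_)
    have := coherentWeight₁_mul_cexp 0 t
    simp only [Complex.ofReal_zero, mul_zero, zero_mul, neg_zero, Complex.exp_zero, one_mul] at this
    simpa using this.symm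
  simpa using h'.re

/-- The Fourier transform of the outer weight: `coherentWeight₁` is the convolution of a
hyperbolic secant with an odd function, whence the hyperbolic tangent. -/
theorem integral_cexp_mul_coherentWeight₁ (δ : ℝ) :
    ∫ t : ℝ, Complex.exp (-(Complex.I * δ * t)) * coherentWeight₁ t
      = Complex.I * ((Real.sqrt (Real.pi / 2) / 2 * Real.exp (-1 / 8) * Real.exp (-δ ^ 2 / 8)
        * Real.tanh (δ / 4) : ℝ) : ℂ) := by
  simp_rw [coherentWeight₁_mul_cexp]
  refine (integral_convolution (ContinuousLinearMap.mul ℝ ℂ)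
    (Integrable.cexp_I_mul integrable_inv_cosh.ofReal δ)
    (Integrable.cexp_I_mul integrable_sin_mul_gaussian.neg.ofReal δ)).trans ?_
  have hneg : ∫ u : ℝ, Complex.exp (-(Complex.I * δ * u)) *
        ((-(Real.sin u * Real.exp (-2 * u ^ 2)) : ℝ) : ℂ)
      = -(-Complex.I * Real.sqrt (Real.pi / 2) * Real.exp (-1 / 8) * Real.exp (-δ ^ 2 / 8)
        * Real.sinh (δ / 4)) := by
    simp only [Complex.ofReal_neg, mul_neg, integral_neg]
    rw [integral_cexp_mul_sin_mul_gaussian δ]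
  refine (congrArg₂ (· * ·) (integral_cexp_mul_inv_cosh δ) hneg).trans ?_
  rw [Real.tanh_eq_sinh_div_cosh]
  have hc : (Real.cosh (δ / 4) : ℂ) ≠ 0 := by exact_mod_cast (Real.cosh_pos _).ne'
  push_cast at hc ⊢
  field_simp

theorem coherentWeight₂_eq (t : ℝ) :
    coherentWeight₂ t = ((2 * Real.exp (1 / 8) / Real.pi : ℝ) : ℂ) *
      Complex.exp (-(4 : ℝ) * t ^ 2 + (-2 * Complex.I) * t + 0) := by
  rw [coherentWeight₂]
  push_cast
  congr 2
  ring

theorem integrable_coherentWeight₂ : Integrable coherentWeight₂ := by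
  rw [funext coherentWeight₂_eq]
  exact (integrable_cexp_neg_sq_add_linear four_pos _ _).const_mul _

theorem integral_cexp_mul_coherentWeight₂ (s : ℝ) :
    ∫ t : ℝ, Complex.exp (-(Complex.I * s * t)) * coherentWeight₂ t
      = ((Real.exp (1 / 8) / Real.sqrt Real.pi * Real.exp (-(2 + s) ^ 2 / 16) : ℝ) : ℂ) := by
  have hfun : ∀ t : ℝ, Complex.exp (-(Complex.I * s * t)) * coherentWeight₂ t
      = ((2 * Real.exp (1 / 8) / Real.pi : ℝ) : ℂ) *
      Complex.exp (-(4 : ℝ) * t ^ 2 + (-Complex.I * (2 + s)) * t + 0) := by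
    intro t
    rw [coherentWeight₂_eq, mul_left_comm, ← Complex.exp_add]
    congr 2
    ring
  simp_rw [hfun]
  rw [integral_const_mul, integral_cexp_neg_sq_add_linear four_pos,
    show (0 : ℂ) + (-Complex.I * (2 + s)) ^ 2 / (4 * (4 : ℝ)) = ((-(2 + s) ^ 2 / 16 : ℝ) : ℂ) by
      rw [mul_pow, neg_sq, Complex.I_sq]; push_cast; ring]
  rw [← Complex.ofReal_exp, ← Complex.ofReal_mul, ← Complex.ofReal_mul]
  congr 1
  rw [Real.sqrt_div Real.pi_pos.le, show (4 : ℝ) = 2 ^ 2 by norm_num, Real.sqrt_sq two_pos.le]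
  have hpi := Real.sqrt_pos.2 Real.pi_pos
  have hsq := Real.sq_sqrt Real.pi_pos.le
  field_simp
  rw [hsq]

theorem integrable_gaussianFilter {β : ℝ} (hβ : 0 < β) : Integrable (gaussianFilter β) := by
  have h := (integrable_exp_neg_mul_sq (b := (β ^ 2)⁻¹) (by positivity)).const_mul
    (Real.sqrt (Real.sqrt (2 / Real.pi) / β))
  refine h.congr (Eventually.of_forall fun t => ?_)
  simp only [gaussianFilter]
  congr 2
  ring

/-- The filter in frequency space: `fourierJump` multiplies the matrix entry of the jump operator
with Bohr frequency `ν` by `frequencyFilter β (ω - ν)`. -/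
def frequencyFilter (β u : ℝ) : ℝ :=
  Real.sqrt (β * Real.sqrt (2 / Real.pi) / 2) * Real.exp (-(β * u) ^ 2 / 4)

theorem integral_cexp_mul_gaussianFilter {β : ℝ} (hβ : 0 < β) (u : ℝ) :
    ((Real.sqrt (2 * Real.pi))⁻¹ : ℂ) *
      ∫ t : ℝ, Complex.exp (-(Complex.I * u * t)) * gaussianFilter β t
      = frequencyFilter β u := by
  have hfun : ∀ t : ℝ, Complex.exp (-(Complex.I * u * t)) * gaussianFilter β t
      = (Real.sqrt (Real.sqrt (2 / Real.pi) / β) : ℂ) *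
      Complex.exp (-(((β ^ 2)⁻¹ : ℝ) : ℂ) * t ^ 2 + (-Complex.I * u) * t + 0) := by
    intro t
    rw [gaussianFilter, Complex.ofReal_mul, mul_left_comm, Complex.ofReal_exp, ← Complex.exp_add]
    push_cast
    congr 2
    ring
  simp_rw [hfun]
  rw [integral_const_mul, integral_cexp_neg_sq_add_linear (by positivity),
    show (0 : ℂ) + (-Complex.I * u) ^ 2 / (4 * ((β ^ 2)⁻¹ : ℝ)) = ((-(β * u) ^ 2 / 4 : ℝ) : ℂ) by
      rw [mul_pow, neg_sq, Complex.I_sq]; push_cast; field_simp; ring]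
  rw [← Complex.ofReal_exp, ← Complex.ofReal_mul, ← Complex.ofReal_mul, ← Complex.ofReal_inv,
    ← Complex.ofReal_mul, frequencyFilter]
  congr 1
  rw [← mul_assoc, ← mul_assoc]
  congr 1
  rw [← Real.sqrt_inv, ← Real.sqrt_mul (by positivity), ← Real.sqrt_mul (by positivity)]
  congr 1
  have hpi := Real.pi_pos
  field_simp

/-- The matrix of coefficients of the dissipative part in the Bohr frequencies `a₁ / β`, `a₂ / β`. -/
def kossakowski (a₁ a₂ : ℝ) : ℝ :=
  (Real.sqrt 2)⁻¹ * Real.exp (-(1 + (a₁ + a₂) / 2) ^ 2 / 4 - (a₁ - a₂) ^ 2 / 8)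

theorem transitionWeight_mul_frequencyFilter {β : ℝ} (ω ν₁ ν₂ : ℝ) (hβ : 0 < β) :
    transitionWeight β ω * (frequencyFilter β (ω - ν₁) * frequencyFilter β (ω - ν₂))
      = β * Real.sqrt (2 / Real.pi) / 2 * Real.exp (-(1 + (β * ν₁ + β * ν₂) / 2) ^ 2 / 4
          - (β * ν₁ - β * ν₂) ^ 2 / 8) *
        Real.exp (-β ^ 2 * (ω + (1 - (β * ν₁ + β * ν₂) / 2) / (2 * β)) ^ 2) := by
  rw [transitionWeight, frequencyFilter, frequencyFilter, mul_mul_mul_comm,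
    Real.mul_self_sqrt (by positivity), mul_left_comm, ← Real.exp_add, ← Real.exp_add, mul_assoc,
    ← Real.exp_add]
  congr 2
  field_simp
  ring

theorem integrable_transitionWeight_mul_frequencyFilter {β : ℝ} (hβ : 0 < β) (ν₁ ν₂ : ℝ) :
    Integrable fun ω =>
      transitionWeight β ω * (frequencyFilter β (ω - ν₁) * frequencyFilter β (ω - ν₂)) := by
  simp_rw [fun ω => transitionWeight_mul_frequencyFilter ω ν₁ ν₂ hβ]
  have h := integrable_exp_neg_mul_sq (b := β ^ 2) (by positivity)
  exact (h.comp_add_right _).const_mul _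

theorem integral_transitionWeight_mul_frequencyFilter {β : ℝ} (hβ : 0 < β) (ν₁ ν₂ : ℝ) :
    ∫ ω, transitionWeight β ω * (frequencyFilter β (ω - ν₁) * frequencyFilter β (ω - ν₂))
      = kossakowski (β * ν₁) (β * ν₂) := by
  simp_rw [fun ω => transitionWeight_mul_frequencyFilter ω ν₁ ν₂ hβ]
  rw [integral_const_mul, integral_add_right_eq_self (fun ω : ℝ => Real.exp (-β ^ 2 * ω ^ 2)),
    integral_gaussian, kossakowski, mul_right_comm]
  congr 1
  rw [Real.sqrt_div Real.pi_pos.le, Real.sqrt_sq hβ.le, Real.sqrt_div two_pos.le]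
  have := Real.sqrt_pos.2 Real.pi_pos
  have h2 := Real.sq_sqrt (zero_le_two : (0 : ℝ) ≤ 2)
  field_simp
  rw [h2]

theorem kossakowski_comm (a₁ a₂ : ℝ) : kossakowski a₁ a₂ = kossakowski a₂ a₁ := by
  rw [kossakowski, kossakowski, add_comm a₁ a₂, show (a₁ - a₂) ^ 2 = (a₂ - a₁) ^ 2 by ring]

/-- The detailed balance relation of the transition weight. -/
theorem kossakowski_neg (a₁ a₂ : ℝ) :
    kossakowski (-a₁) (-a₂) = Real.exp ((a₁ + a₂) / 2) * kossakowski a₁ a₂ := by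
  rw [kossakowski, kossakowski, mul_left_comm, ← Real.exp_add]
  congr 2
  ring

theorem integrable_transitionWeight {β : ℝ} (hβ : 0 < β) : Integrable (transitionWeight β) := by
  have h := (integrable_exp_neg_mul_sq (b := β ^ 2 / 2) (by positivity)).comp_add_right (1 / β)
  refine h.congr (Eventually.of_forall fun ω => ?_)
  simp only [transitionWeight]
  congr 1
  field_simp

/-! ### Matrix entries of the Gibbs sampler of a diagonal Hamiltonian -/

section Entries

set_option linter.unusedSectionVars false

variable {V : Type} [Fintype V] [DecidableEq V]

/-- The Hamiltonian that is diagonal in the computational basis with energies `E`. -/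
def classicalHamiltonian (E : (V → Fin 2) → ℝ) : Op V := Matrix.diagonal fun x => (E x : ℂ)

/-- A matrix entry, as a continuous linear functional. -/
def entryCLM (x y : V → Fin 2) : Op V →L[ℂ] ℂ :=
  LinearMap.toContinuousLinearMap (Matrix.entryLinearMap ℂ ℂ x y)

@[simp] theorem entryCLM_apply (x y : V → Fin 2) (A : Op V) : entryCLM x y A = A x y := rfl

/-- Evaluation of superoperators at an operator, as a continuous linear map. -/
def evalCLM (X : Op V) : SuperOp V →L[ℂ] Op V := ContinuousLinearMap.apply ℂ (Op V) X

@[simp] theorem evalCLM_apply (X : Op V) (S : SuperOp V) : evalCLM X S = S X := rfl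

theorem integral_entry {F : ℝ → Op V} (hF : Integrable F) (x y : V → Fin 2) :
    (∫ t, F t) x y = ∫ t, F t x y :=
  ((entryCLM x y).integral_comp_comm hF).symm

theorem integrable_of_entry {F : ℝ → Op V} (hF : ∀ x y, Integrable fun t => F t x y) :
    Integrable F := by
  have h : F = fun t => ∑ x, ∑ y, F t x y • (Matrix.single x y 1 : Op V) := by
    ext1 t
    conv_lhs => rw [Matrix.matrix_eq_sum_single (F t)]
    simp [Matrix.smul_single]
  rw [h]
  exact integrable_finsetSum _ fun x _ => integrable_finsetSum _ fun y _ =>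
    (hF x y).smul_const _

theorem evolve_classicalHamiltonian (E : (V → Fin 2) → ℝ) (A : Op V) (t : ℝ) :
    evolve (classicalHamiltonian E) A t
      = Matrix.diagonal (fun x => Complex.exp (((t * E x : ℝ) : ℂ) * Complex.I)) * A
        * Matrix.diagonal (fun x => Complex.exp (((-(t * E x) : ℝ) : ℂ) * Complex.I)) := by
  rw [evolve, classicalHamiltonian, ← Matrix.diagonal_smul, ← Matrix.diagonal_smul,
    Matrix.exp_diagonal, Matrix.exp_diagonal]
  congr
  · ext x
    rw [Pi.coe_exp, ← Complex.exp_eq_exp_ℂ]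
    simp only [Pi.smul_apply, smul_eq_mul]
    congr 1
    push_cast
    ring
  · ext x
    rw [Pi.coe_exp, ← Complex.exp_eq_exp_ℂ]
    simp only [Pi.smul_apply, smul_eq_mul]
    congr 1
    push_cast
    ring

theorem evolve_apply (E : (V → Fin 2) → ℝ) (A : Op V) (t : ℝ) (x y : V → Fin 2) :
    evolve (classicalHamiltonian E) A t x y
      = Complex.exp (Complex.I * t * (E x - E y)) * A x y := by
  rw [evolve_classicalHamiltonian, Matrix.mul_diagonal, Matrix.diagonal_mul, mul_right_comm,
    ← Complex.exp_add]
  congr 2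
  push_cast
  ring

theorem norm_evolve_le (E : (V → Fin 2) → ℝ) (A : Op V) (t : ℝ) :
    ‖evolve (classicalHamiltonian E) A t‖ ≤ ‖A‖ := by
  have hd : ∀ θ : (V → Fin 2) → ℝ,
      ‖(Matrix.diagonal fun x => Complex.exp ((θ x : ℂ) * Complex.I) : Op V)‖ ≤ 1 := by
    intro θ
    rw [Matrix.l2_opNorm_diagonal]
    exact (pi_norm_le_iff_of_nonneg zero_le_one).2 fun x =>
      (Complex.norm_exp_ofReal_mul_I _).le
  rw [evolve_classicalHamiltonian]
  refine (norm_mul_le _ _).trans ?_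
  refine (mul_le_mul ((norm_mul_le _ _).trans (mul_le_mul_of_nonneg_right (hd fun x => t * E x)
    (norm_nonneg _))) (hd fun x => -(t * E x)) (norm_nonneg _) (by positivity)).trans ?_
  simp

variable {β : ℝ} (E : (V → Fin 2) → ℝ) (A : Op V)

theorem fourierJump_integrand_entry (ω t : ℝ) (x y : V → Fin 2) :
    ((Complex.exp (-(Complex.I * ω * t)) * gaussianFilter β t) •
        evolve (classicalHamiltonian E) A t) x y
      = (Complex.exp (-(Complex.I * (ω - (E x - E y) : ℝ) * t)) * gaussianFilter β t) * A x y := by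
  rw [Matrix.smul_apply, evolve_apply, smul_eq_mul, ← mul_assoc]
  congr 1
  rw [mul_right_comm, ← Complex.exp_add]
  congr 2
  push_cast
  ring

theorem fourierJump_apply (hβ : 0 < β) (ω : ℝ) (x y : V → Fin 2) :
    fourierJump β (classicalHamiltonian E) A ω x y
      = frequencyFilter β (ω - (E x - E y)) * A x y := by
  rw [fourierJump, Matrix.smul_apply, integral_entry]
  · simp_rw [fourierJump_integrand_entry]
    rw [integral_mul_const, smul_eq_mul, ← mul_assoc, integral_cexp_mul_gaussianFilter hβ]
  · refine integrable_of_entry fun x y => ?_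
    simp_rw [fourierJump_integrand_entry]
    exact (Integrable.cexp_I_mul (integrable_gaussianFilter hβ).ofReal _).mul_const _

/-- A bound on the operator norm of `fourierJump` that does not depend on the Hamiltonian. -/
theorem norm_fourierJump_le (hβ : 0 < β) (ω : ℝ) :
    ‖fourierJump β (classicalHamiltonian E) A ω‖
      ≤ (Real.sqrt (2 * Real.pi))⁻¹ * ((∫ t, |gaussianFilter β t|) * ‖A‖) := by
  rw [fourierJump, norm_smul]
  have h1 : ‖((Real.sqrt (2 * Real.pi))⁻¹ : ℂ)‖ = (Real.sqrt (2 * Real.pi))⁻¹ := by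
    rw [norm_inv, Complex.norm_real, Real.norm_of_nonneg (Real.sqrt_nonneg _)]
  rw [h1]
  refine mul_le_mul_of_nonneg_left ?_ (by positivity)
  rw [← integral_mul_const]
  refine norm_integral_le_of_norm_le ((integrable_gaussianFilter hβ).abs.mul_const _)
    (Eventually.of_forall fun t => ?_)
  rw [norm_smul, norm_mul, Complex.norm_real, Real.norm_eq_abs,
    show -(Complex.I * ω * t) = ((-(ω * t) : ℝ) : ℂ) * Complex.I by push_cast; ring,
    Complex.norm_exp_ofReal_mul_I, one_mul]
  exact mul_le_mul_of_nonneg_left (norm_evolve_le E A t) (abs_nonneg _)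

theorem coherentInner_integrand_entry (t : ℝ) (x y : V → Fin 2) :
    (coherentWeight₂ t • (evolve (classicalHamiltonian E) Aᴴ (β * t) *
        evolve (classicalHamiltonian E) A (-(β * t)))) x y
      = ∑ z, (Complex.exp (-(Complex.I * (β * (E z - E x) + β * (E z - E y) : ℝ) * t))
          * coherentWeight₂ t) * (star (A z x) * A z y) := by
  rw [Matrix.smul_apply, Matrix.mul_apply, smul_eq_mul, Finset.mul_sum]
  refine Finset.sum_congr rfl fun z _ => ?_
  rw [evolve_apply, evolve_apply, Matrix.conjTranspose_apply, mul_mul_mul_comm, ← Complex.exp_add,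
    ← mul_assoc, mul_comm (coherentWeight₂ t)]
  congr 3
  push_cast
  ring

theorem integrable_coherentInner :
    Integrable fun t : ℝ => coherentWeight₂ t • (evolve (classicalHamiltonian E) Aᴴ (β * t) *
        evolve (classicalHamiltonian E) A (-(β * t))) := by
  refine integrable_of_entry fun x y => ?_
  simp_rw [coherentInner_integrand_entry]
  exact integrable_finsetSum _ fun z _ =>
    (Integrable.cexp_I_mul integrable_coherentWeight₂ _).mul_const _

theorem coherentInner_apply (x y : V → Fin 2) :
    (∫ t : ℝ, coherentWeight₂ t • (evolve (classicalHamiltonian E) Aᴴ (β * t) *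
        evolve (classicalHamiltonian E) A (-(β * t)))) x y
      = ∑ z, ((Real.exp (1 / 8) / Real.sqrt Real.pi *
          Real.exp (-(2 + (β * (E z - E x) + β * (E z - E y))) ^ 2 / 16) : ℝ) : ℂ)
            * (star (A z x) * A z y) := by
  rw [integral_entry (integrable_coherentInner E A)]
  simp_rw [coherentInner_integrand_entry]
  rw [integral_finsetSum]
  · refine Finset.sum_congr rfl fun z _ => ?_
    rw [integral_mul_const, integral_cexp_mul_coherentWeight₂]
  · exact fun z _ => (Integrable.cexp_I_mul integrable_coherentWeight₂ _).mul_const _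

/-- The coefficient of `coherentTerm` in the Bohr frequencies `a₁ / β`, `a₂ / β`. -/
def coherentCoeff (a₁ a₂ : ℝ) : ℂ :=
  Complex.I * ((kossakowski a₁ a₂ / 2 * Real.tanh ((a₂ - a₁) / 4) : ℝ) : ℂ)

theorem coherentOuter_integrand_entry (C : Op V) (t : ℝ) (x y : V → Fin 2) :
    ((coherentWeight₁ t : ℂ) • evolve (classicalHamiltonian E) C (-(β * t))) x y
      = (Complex.exp (-(Complex.I * (β * (E x - E y) : ℝ) * t)) * coherentWeight₁ t) * C x y := by
  rw [Matrix.smul_apply, evolve_apply, smul_eq_mul, ← mul_assoc, mul_comm (coherentWeight₁ t : ℂ)]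
  congr 3
  push_cast
  ring

theorem coherentTerm_apply (x y : V → Fin 2) :
    coherentTerm β (classicalHamiltonian E) A x y
      = ∑ z, coherentCoeff (β * (E z - E x)) (β * (E z - E y)) * (star (A z x) * A z y) := by
  rw [coherentTerm, integral_entry]
  · simp_rw [coherentOuter_integrand_entry]
    rw [integral_mul_const, integral_cexp_mul_coherentWeight₁, coherentInner_apply, Finset.mul_sum]
    refine Finset.sum_congr rfl fun z _ => ?_
    rw [← mul_assoc, mul_assoc Complex.I, ← Complex.ofReal_mul, coherentCoeff]
    congr 3
    rw [show (β * (E z - E y) - β * (E z - E x)) / 4 = β * (E x - E y) / 4 by ring]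
    rw [mul_mul_mul_comm, mul_comm (Real.tanh _), ← mul_assoc]
    congr 1
    rw [kossakowski, mul_right_comm, show (-1 / 8 : ℝ) = -(1 / 8) by norm_num, Real.exp_neg]
    rw [show Real.exp (-(1 + (β * (E z - E x) + β * (E z - E y)) / 2) ^ 2 / 4
        - (β * (E z - E x) - β * (E z - E y)) ^ 2 / 8)
        = Real.exp (-(β * (E x - E y)) ^ 2 / 8)
          * Real.exp (-(2 + (β * (E z - E x) + β * (E z - E y))) ^ 2 / 16) by
      rw [← Real.exp_add]; congr 1; ring]
    have hpi := Real.sqrt_pos.2 Real.pi_pos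
    have h2 := Real.sqrt_pos.2 two_pos
    have he := Real.exp_pos (1 / 8)
    rw [Real.sqrt_div Real.pi_pos.le]
    field_simp
  · refine integrable_of_entry fun x y => ?_
    simp_rw [coherentOuter_integrand_entry]
    exact (Integrable.cexp_I_mul integrable_coherentWeight₁.ofReal _).mul_const _

theorem star_coherentCoeff (a₁ a₂ : ℝ) : star (coherentCoeff a₁ a₂) = coherentCoeff a₂ a₁ := by
  rw [coherentCoeff, coherentCoeff, star_mul', kossakowski_comm a₁ a₂,
    show (a₂ - a₁) / 4 = -((a₁ - a₂) / 4) by ring, Real.tanh_neg, Complex.star_def,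
    Complex.conj_ofReal, Complex.conj_I]
  push_cast
  ring

theorem isHermitian_coherentTerm : (coherentTerm β (classicalHamiltonian E) A).IsHermitian := by
  ext x y
  rw [Matrix.conjTranspose_apply, coherentTerm_apply, coherentTerm_apply, star_sum]
  refine Finset.sum_congr rfl fun z _ => ?_
  rw [star_mul', star_mul', star_star, star_coherentCoeff]
  exact congrArg _ (mul_comm _ _)

/-- A bound on the coherent term that does not depend on the Hamiltonian. -/
theorem norm_coherentTerm_le :
    ‖coherentTerm β (classicalHamiltonian E) A‖
      ≤ (∫ t, |coherentWeight₁ t|) * ((∫ t, ‖coherentWeight₂ t‖) * ‖A‖ ^ 2) := by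
  have hinner : ‖∫ t : ℝ, coherentWeight₂ t • (evolve (classicalHamiltonian E) Aᴴ (β * t) *
        evolve (classicalHamiltonian E) A (-(β * t)))‖ ≤ (∫ t, ‖coherentWeight₂ t‖) * ‖A‖ ^ 2 := by
    rw [← integral_mul_const]
    refine norm_integral_le_of_norm_le (integrable_coherentWeight₂.norm.mul_const _)
      (Eventually.of_forall fun t => ?_)
    rw [norm_smul]
    refine mul_le_mul_of_nonneg_left ?_ (norm_nonneg _)
    refine (norm_mul_le _ _).trans ?_
    rw [sq]
    refine mul_le_mul ?_ (norm_evolve_le E A _) (norm_nonneg _) (norm_nonneg _)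
    exact (norm_evolve_le E Aᴴ _).trans_eq (Matrix.l2_opNorm_conjTranspose A)
  rw [coherentTerm, ← integral_mul_const]
  refine norm_integral_le_of_norm_le (integrable_coherentWeight₁.abs.mul_const _)
    (Eventually.of_forall fun t => ?_)
  rw [norm_smul, Complex.norm_real, Real.norm_eq_abs]
  exact mul_le_mul_of_nonneg_left ((norm_evolve_le E _ _).trans hinner) (abs_nonneg _)

end Entries

section FixedPoint

set_option linter.unusedSectionVars false

variable {V : Type} [Fintype V] [DecidableEq V]

theorem norm_leftMul_le (A : Op V) : ‖leftMul A‖ ≤ ‖A‖ :=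
  ContinuousLinearMap.opNorm_mul_apply_le ℂ (Op V) A

theorem norm_rightMul_le (A : Op V) : ‖rightMul A‖ ≤ ‖A‖ :=
  ContinuousLinearMap.opNorm_le_bound _ (norm_nonneg A) fun X => by
    rw [mul_comm ‖A‖]
    exact norm_mul_le X A

theorem norm_dissipator_le (K : Op V) : ‖dissipator K‖ ≤ 2 * ‖K‖ ^ 2 := by
  have hK : ‖Kᴴ‖ = ‖K‖ := Matrix.l2_opNorm_conjTranspose K
  have h1 : ‖leftMul K * rightMul Kᴴ‖ ≤ ‖K‖ ^ 2 := by
    refine (norm_mul_le _ _).trans ?_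
    rw [sq]
    exact mul_le_mul (norm_leftMul_le K) ((norm_rightMul_le _).trans_eq hK) (norm_nonneg _)
      (norm_nonneg _)
  have hKK : ‖Kᴴ * K‖ ≤ ‖K‖ ^ 2 := by
    refine (norm_mul_le _ _).trans_eq ?_
    rw [hK, sq]
  have h2 : ‖(1 / 2 : ℂ) • (leftMul (Kᴴ * K) + rightMul (Kᴴ * K))‖ ≤ ‖K‖ ^ 2 := by
    rw [norm_smul]
    have h3 := (norm_add_le (leftMul (Kᴴ * K)) (rightMul (Kᴴ * K))).trans
      (add_le_add (norm_leftMul_le _) (norm_rightMul_le _))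
    have h4 : ‖(1 / 2 : ℂ)‖ = 1 / 2 := by norm_num
    rw [h4]
    linarith
  refine (norm_sub_le _ _).trans ?_
  linarith

theorem continuous_dissipator : Continuous (dissipator : Op V → SuperOp V) := by
  have hl : Continuous (leftMul : Op V → SuperOp V) := (ContinuousLinearMap.mul ℂ (Op V)).continuous
  have hr : Continuous (rightMul : Op V → SuperOp V) :=
    (ContinuousLinearMap.mul ℂ (Op V)).flip.continuous
  have hs : Continuous fun K : Op V => Kᴴ := continuous_id.matrix_conjTranspose
  have hk : Continuous fun K : Op V => Kᴴ * K := hs.mul continuous_id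
  have hsum : Continuous fun K : Op V => leftMul (Kᴴ * K) + rightMul (Kᴴ * K) :=
    (hl.comp hk).add (hr.comp hk)
  have hsmul : Continuous fun K : Op V => (1 / 2 : ℂ) • (leftMul (Kᴴ * K) + rightMul (Kᴴ * K)) :=
    hsum.const_smul (1 / 2 : ℂ)
  have hmul : Continuous fun K : Op V => leftMul K * rightMul Kᴴ := hl.mul (hr.comp hs)
  exact hmul.sub hsmul

variable {β : ℝ} (E : (V → Fin 2) → ℝ)

theorem continuous_fourierJump (hβ : 0 < β) (A : Op V) :
    Continuous (fourierJump β (classicalHamiltonian E) A) := by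
  refine continuous_matrix fun x y => ?_
  simp_rw [fourierJump_apply E A hβ]
  unfold frequencyFilter
  fun_prop

/-- The norm of `fourierJump` is at most this constant times the norm of the jump operator. -/
def jumpBound (β : ℝ) : ℝ := (Real.sqrt (2 * Real.pi))⁻¹ * ∫ t, |gaussianFilter β t|

theorem transitionWeight_nonneg (β ω : ℝ) : 0 ≤ transitionWeight β ω := (Real.exp_pos _).le

theorem norm_fourierJump_le_jumpBound (hβ : 0 < β) {A : Op V} (hA : ‖A‖ ≤ 1) (ω : ℝ) :
    ‖fourierJump β (classicalHamiltonian E) A ω‖ ≤ jumpBound β := by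
  refine (norm_fourierJump_le E A hβ ω).trans ?_
  rw [← mul_assoc]
  exact mul_le_of_le_one_right (mul_nonneg (by positivity)
    (integral_nonneg fun _ => abs_nonneg _)) hA

theorem norm_smul_dissipator_le (hβ : 0 < β) {A : Op V} (hA : ‖A‖ ≤ 1) (ω : ℝ) :
    ‖(transitionWeight β ω : ℂ) • dissipator (fourierJump β (classicalHamiltonian E) A ω)‖
      ≤ transitionWeight β ω * (2 * jumpBound β ^ 2) := by
  rw [norm_smul, Complex.norm_real, Real.norm_of_nonneg (transitionWeight_nonneg β ω)]
  refine mul_le_mul_of_nonneg_left ((norm_dissipator_le _).trans ?_) (transitionWeight_nonneg β ω)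
  exact mul_le_mul_of_nonneg_left (pow_le_pow_left₀ (norm_nonneg _)
    (norm_fourierJump_le_jumpBound E hβ hA ω) 2) zero_le_two

theorem integrable_dissipator (hβ : 0 < β) {A : Op V} (hA : ‖A‖ ≤ 1) :
    Integrable fun ω => (transitionWeight β ω : ℂ) •
      dissipator (fourierJump β (classicalHamiltonian E) A ω) := by
  refine ((integrable_transitionWeight hβ).mul_const (2 * jumpBound β ^ 2)).mono' ?_
    (Eventually.of_forall fun ω => norm_smul_dissipator_le E hβ hA ω)
  have hw : Continuous fun ω => (transitionWeight β ω : ℂ) := by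
    unfold transitionWeight
    fun_prop
  have hd : Continuous fun ω => dissipator (fourierJump β (classicalHamiltonian E) A ω) :=
    continuous_dissipator.comp (continuous_fourierJump E hβ A)
  have h : Continuous fun ω => (transitionWeight β ω : ℂ) •
      dissipator (fourierJump β (classicalHamiltonian E) A ω) := hw.smul hd
  exact h.aestronglyMeasurable

theorem dissipator_diagonal_entry (K : Op V) (p : (V → Fin 2) → ℂ) (x y : V → Fin 2) :
    dissipator K (Matrix.diagonal p) x y
      = ∑ z, (K x z * p z * star (K y z)
          - 1 / 2 * (star (K z x) * K z y) * (p x + p y)) := by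
  rw [dissipator_apply, Matrix.sub_apply, Matrix.smul_apply, Matrix.add_apply, Matrix.mul_apply,
    Matrix.mul_diagonal, Matrix.diagonal_mul, Matrix.mul_apply, Finset.sum_sub_distrib]
  congr 1
  · exact Finset.sum_congr rfl fun z _ => by rw [Matrix.mul_diagonal, Matrix.conjTranspose_apply]
  · simp only [Matrix.conjTranspose_apply, smul_eq_mul]
    rw [← Finset.sum_mul, ← Finset.mul_sum]
    ring

theorem integral_dissipator_diagonal_entry (hβ : 0 < β) {A : Op V} (hA : ‖A‖ ≤ 1)
    (p : (V → Fin 2) → ℂ) (x y : V → Fin 2) :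
    (∫ ω, (transitionWeight β ω : ℂ) • dissipator (fourierJump β (classicalHamiltonian E) A ω))
        (Matrix.diagonal p) x y
      = ∑ z, (kossakowski (β * (E x - E z)) (β * (E y - E z)) * (A x z * p z * star (A y z))
          - kossakowski (β * (E z - E x)) (β * (E z - E y)) *
            (1 / 2 * (star (A z x) * A z y) * (p x + p y))) := by
  have h := ((entryCLM x y).comp (evalCLM (Matrix.diagonal p))).integral_comp_comm
    (integrable_dissipator E hβ hA)
  refine h.symm.trans ?_
  have hfun : ∀ ω, ((entryCLM x y).comp (evalCLM (Matrix.diagonal p)))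
      ((transitionWeight β ω : ℂ) • dissipator (fourierJump β (classicalHamiltonian E) A ω))
      = ∑ z, (((transitionWeight β ω * (frequencyFilter β (ω - (E x - E z)) *
            frequencyFilter β (ω - (E y - E z))) : ℝ) : ℂ) * (A x z * p z * star (A y z))
          - ((transitionWeight β ω * (frequencyFilter β (ω - (E z - E x)) *
            frequencyFilter β (ω - (E z - E y))) : ℝ) : ℂ) *
              (1 / 2 * (star (A z x) * A z y) * (p x + p y))) := by
    intro ω
    rw [ContinuousLinearMap.comp_apply, evalCLM_apply, entryCLM_apply, SuperOp.smul_apply,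
      Matrix.smul_apply, dissipator_diagonal_entry, smul_eq_mul, Finset.mul_sum]
    refine Finset.sum_congr rfl fun z _ => ?_
    simp only [fourierJump_apply E A hβ, star_mul', Complex.star_def, Complex.conj_ofReal]
    push_cast
    ring
  have hint : ∀ (ν₁ ν₂ : ℝ) (c : ℂ), Integrable fun ω => ((transitionWeight β ω *
      (frequencyFilter β (ω - ν₁) * frequencyFilter β (ω - ν₂)) : ℝ) : ℂ) * c :=
    fun ν₁ ν₂ c => (integrable_transitionWeight_mul_frequencyFilter hβ ν₁ ν₂).ofReal.mul_const c
  simp_rw [hfun]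
  refine (integral_finsetSum _ fun z _ => by exact (hint _ _ _).sub (hint _ _ _)).trans ?_
  refine Finset.sum_congr rfl fun z _ => ?_
  rw [integral_sub (hint _ _ _) (hint _ _ _), integral_mul_const, integral_mul_const,
    integral_complex_ofReal, integral_complex_ofReal,
    integral_transitionWeight_mul_frequencyFilter hβ,
    integral_transitionWeight_mul_frequencyFilter hβ]

/-- The action of the Gibbs sampler on diagonal operators. -/
theorem gibbsSampler_diagonal_apply (hβ : 0 < β) {J : ℕ} {A : Fin J → Op V} (hA : ∀ a, ‖A a‖ ≤ 1)
    (p : (V → Fin 2) → ℂ) (x y : V → Fin 2) :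
    gibbsSampler β (classicalHamiltonian E) A (Matrix.diagonal p) x y
      = ∑ a, ∑ z, (kossakowski (β * (E x - E z)) (β * (E y - E z)) *
            (A a x z * p z * star (A a y z))
          + (-Complex.I * coherentCoeff (β * (E z - E x)) (β * (E z - E y)) * (p y - p x)
            - kossakowski (β * (E z - E x)) (β * (E z - E y)) * (1 / 2 * (p x + p y)))
            * (star (A a z x) * A a z y)) := by
  have h : gibbsSampler β (classicalHamiltonian E) A (Matrix.diagonal p) x y
      = -Complex.I * (∑ a, coherentTerm β (classicalHamiltonian E) (A a) x y * (p y - p x))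
      + ∑ a, (∫ ω, (transitionWeight β ω : ℂ) •
          dissipator (fourierJump β (classicalHamiltonian E) (A a) ω)) (Matrix.diagonal p) x y := by
    rw [gibbsSampler, SuperOp.add_apply, SuperOp.smul_apply, commutator_apply, Matrix.add_apply,
      Matrix.smul_apply, Matrix.sub_apply, Matrix.mul_diagonal, Matrix.diagonal_mul, smul_eq_mul,
      ← Finset.sum_mul, ← Matrix.sum_apply]
    congr 2
    · ring
    · have := map_sum (evalCLM (Matrix.diagonal p)) (fun a => ∫ ω, (transitionWeight β ω : ℂ) •
          dissipator (fourierJump β (classicalHamiltonian E) (A a) ω)) Finset.univ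
      simp only [evalCLM_apply] at this
      rw [this, Matrix.sum_apply]
  rw [h, Finset.mul_sum, ← Finset.sum_add_distrib]
  refine Finset.sum_congr rfl fun a _ => ?_
  rw [integral_dissipator_diagonal_entry E hβ (hA a), coherentTerm_apply, Finset.sum_mul,
    Finset.mul_sum, ← Finset.sum_add_distrib]
  refine Finset.sum_congr rfl fun z _ => ?_
  ring

theorem gibbsState_classicalHamiltonian (β : ℝ) :
    gibbsState (classicalHamiltonian E) β = Matrix.diagonal fun x =>
      ((Real.exp (-β * E x) / ∑ y, Real.exp (-β * E y) : ℝ) : ℂ) := by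
  have h : NormedSpace.exp ((-β : ℂ) • classicalHamiltonian E)
      = Matrix.diagonal fun x => ((Real.exp (-β * E x) : ℝ) : ℂ) := by
    rw [classicalHamiltonian, ← Matrix.diagonal_smul, Matrix.exp_diagonal]
    congr 1
    ext x
    rw [Pi.coe_exp, ← Complex.exp_eq_exp_ℂ]
    simp
  rw [gibbsState, h, Matrix.trace_diagonal, ← Matrix.diagonal_smul]
  congr 1
  ext x
  simp only [Pi.smul_apply, smul_eq_mul]
  push_cast
  rw [div_eq_inv_mul]

/-- The identity behind the fixed point property: the coherent term contributes the left hand side,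
the loss terms and the gain term of the dissipative part contribute the right hand side. -/
theorem tanh_mul_exp_sub_exp (a b : ℝ) :
    Real.tanh ((b - a) / 4) * (Real.exp b - Real.exp a)
      = Real.exp a + Real.exp b - 2 * Real.exp ((a + b) / 2) := by
  have hu : Real.exp a = Real.exp (a / 2) ^ 2 := by rw [← Real.exp_nat_mul]; congr 1; push_cast; ring
  have hv : Real.exp b = Real.exp (b / 2) ^ 2 := by rw [← Real.exp_nat_mul]; congr 1; push_cast; ring
  have huv : Real.exp ((a + b) / 2) = Real.exp (a / 2) * Real.exp (b / 2) := by
    rw [← Real.exp_add]; congr 1; ring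
  have ht : Real.tanh ((b - a) / 4) * (Real.exp (b / 2) + Real.exp (a / 2))
      = Real.exp (b / 2) - Real.exp (a / 2) := by
    have h1 : Real.exp (b / 2) = Real.exp ((a + b) / 4) * Real.exp ((b - a) / 4) := by
      rw [← Real.exp_add]; congr 1; ring
    have h2 : Real.exp (a / 2) = Real.exp ((a + b) / 4) * Real.exp (-((b - a) / 4)) := by
      rw [← Real.exp_add]; congr 1; ring
    have hc := Real.cosh_pos ((b - a) / 4)
    rw [h1, h2, ← mul_add, ← mul_sub, Real.tanh_eq_sinh_div_cosh, Real.sinh_eq]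
    have hc' : Real.exp ((b - a) / 4) + Real.exp (-((b - a) / 4))
        = 2 * Real.cosh ((b - a) / 4) := by rw [Real.cosh_eq]; ring
    rw [hc']
    field_simp
  rw [hu, hv, huv]
  linear_combination (Real.exp (b / 2) - Real.exp (a / 2)) * ht

/-- **The Gibbs state is a fixed point.** After the sum over the jump operators has been reindexed
by the adjoint, all three contributions to a matrix entry carry the factor `conj (A z x) * A z y`,
and their coefficients cancel. -/
theorem gibbsSampler_gibbsState (hβ : 0 < β) {J : ℕ} {A : Fin J → Op V} (hA : ∀ a, ‖A a‖ ≤ 1)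
    (hadj : AdjointClosed A) :
    gibbsSampler β (classicalHamiltonian E) A (gibbsState (classicalHamiltonian E) β) = 0 := by
  obtain ⟨τ, hτ⟩ := hadj
  rw [gibbsState_classicalHamiltonian]
  set Z := ∑ y, Real.exp (-β * E y)
  ext x y
  rw [gibbsSampler_diagonal_apply E hβ hA, Finset.sum_comm, Matrix.zero_apply]
  refine Finset.sum_eq_zero fun z _ => ?_
  rw [Finset.sum_add_distrib]
  have hswap : ∑ a, (kossakowski (β * (E x - E z)) (β * (E y - E z)) : ℂ) *
        (A a x z * ((Real.exp (-β * E z) / Z : ℝ) : ℂ) * star (A a y z))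
      = ∑ a, (kossakowski (β * (E x - E z)) (β * (E y - E z)) : ℂ) *
        ((Real.exp (-β * E z) / Z : ℝ) : ℂ) * (star (A a z x) * A a z y) := by
    rw [← Equiv.sum_comp τ]
    refine Finset.sum_congr rfl fun a _ => ?_
    rw [hτ a, Matrix.conjTranspose_apply, Matrix.conjTranspose_apply, star_star]
    ring
  rw [hswap, ← Finset.mul_sum, ← Finset.mul_sum, ← add_mul]
  refine mul_eq_zero_of_left ?_ _
  rw [show β * (E x - E z) = -(β * (E z - E x)) by ring,
    show β * (E y - E z) = -(β * (E z - E y)) by ring, kossakowski_neg, coherentCoeff,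
    ← mul_assoc (-Complex.I), show -Complex.I * Complex.I = 1 by simp, one_mul]
  have hx : -β * E x = -β * E z + β * (E z - E x) := by ring
  have hy : -β * E y = -β * E z + β * (E z - E y) := by ring
  rw [hx, hy, Real.exp_add, Real.exp_add]
  have h := tanh_mul_exp_sub_exp (β * (E z - E x)) (β * (E z - E y))
  set a₁ := β * (E z - E x)
  set a₂ := β * (E z - E y)
  rw [show (1 / 2 : ℂ) = ((1 / 2 : ℝ) : ℂ) by norm_num]
  norm_cast
  linear_combination kossakowski a₁ a₂ / 2 * (Real.exp (-β * E z) / Z) * h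

end FixedPoint

/-! ### Contractivity of the semigroup in the Heisenberg picture -/

section Contraction

set_option linter.unusedSectionVars false

variable {V : Type} [Fintype V] [DecidableEq V]

instance : LinearMapClass (SuperOp V) ℂ (Op V) (Op V) :=
  inferInstanceAs (LinearMapClass (Op V →L[ℂ] Op V) ℂ (Op V) (Op V))

instance : NormedAlgebra ℚ (SuperOp V) := NormedAlgebra.restrictScalars ℚ ℂ (SuperOp V)

/-- The Heisenberg picture of a superoperator: the adjoint for the pairing
`(O, X) ↦ trace (O * X)`. -/
def heisenberg (S : SuperOp V) : SuperOp V :=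
  LinearMap.toContinuousLinearMap
    { toFun := fun O => Matrix.of fun y x => (O * S (Matrix.single x y 1)).trace
      map_add' := fun O P => by ext; simp [add_mul]
      map_smul' := fun c O => by ext; simp }

theorem heisenberg_apply_apply (S : SuperOp V) (O : Op V) (x y : V → Fin 2) :
    heisenberg S O y x = (O * S (Matrix.single x y 1)).trace := rfl

theorem trace_heisenberg_mul (S : SuperOp V) (O X : Op V) :
    (heisenberg S O * X).trace = (O * S X).trace := by
  have hX : S X = ∑ x, ∑ y, X x y • S (Matrix.single x y 1) := by
    conv_lhs => rw [Matrix.matrix_eq_sum_single X]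
    rw [map_sum]
    refine Finset.sum_congr rfl fun x _ => ?_
    rw [map_sum]
    refine Finset.sum_congr rfl fun y _ => ?_
    rw [← map_smul, Matrix.smul_single, smul_eq_mul, mul_one]
  rw [hX, Finset.mul_sum, Matrix.trace_sum, Matrix.trace, Finset.sum_congr rfl fun y _ => by
    rw [Matrix.diag_apply, Matrix.mul_apply], Finset.sum_comm]
  refine Finset.sum_congr rfl fun x _ => ?_
  rw [Finset.mul_sum, Matrix.trace_sum]
  refine Finset.sum_congr rfl fun y _ => ?_
  rw [heisenberg_apply_apply, Matrix.mul_smul, Matrix.trace_smul, smul_eq_mul, mul_comm]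

theorem heisenberg_eq_iff {S T : SuperOp V} :
    heisenberg S = T ↔ ∀ O X, (T O * X).trace = (O * S X).trace := by
  refine ⟨fun h O X => h ▸ trace_heisenberg_mul S O X, fun h => ?_⟩
  refine DFunLike.ext _ _ fun O => Matrix.ext_iff_trace_mul_right.2 fun X => ?_
  rw [trace_heisenberg_mul, h]

/-- `heisenberg`, as a continuous linear map. -/
def heisenbergCLM : SuperOp V →L[ℂ] SuperOp V :=
  haveI : FiniteDimensional ℂ (SuperOp V) :=
    inferInstanceAs (FiniteDimensional ℂ (Op V →L[ℂ] Op V))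
  LinearMap.toContinuousLinearMap
    { toFun := heisenberg
      map_add' := fun S T => heisenberg_eq_iff.2 fun O X => by
        simp [add_mul, mul_add, trace_heisenberg_mul]
      map_smul' := fun c S => heisenberg_eq_iff.2 fun O X => by
        simp [trace_heisenberg_mul] }

theorem heisenbergCLM_apply (S : SuperOp V) : heisenbergCLM S = heisenberg S := rfl

theorem heisenberg_smul (c : ℂ) (S : SuperOp V) : heisenberg (c • S) = c • heisenberg S :=
  map_smul heisenbergCLM c S

theorem heisenberg_pow (S : SuperOp V) (n : ℕ) : heisenberg (S ^ n) = heisenberg S ^ n := by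
  induction n with
  | zero => exact heisenberg_eq_iff.2 fun O X => by simp
  | succ n ih =>
    refine heisenberg_eq_iff.2 fun O X => ?_
    rw [pow_succ' (heisenberg S), SuperOp.mul_apply, ← ih, trace_heisenberg_mul,
      trace_heisenberg_mul, pow_succ, SuperOp.mul_apply]

theorem heisenberg_exp (S : SuperOp V) :
    heisenberg (NormedSpace.exp S) = NormedSpace.exp (heisenberg S) := by
  have h := (NormedSpace.exp_series_hasSum_exp' (𝕂 := ℂ) S).mapL heisenbergCLM
  refine h.unique ?_
  have h' := NormedSpace.exp_series_hasSum_exp' (𝕂 := ℂ) (heisenberg S)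
  convert h' using 2 with n
  rw [map_smul, heisenbergCLM_apply, heisenberg_pow]

/-- A dissipative generator, in the sense that `1 - h T` is expanding for all `h ≥ 0`, generates a
contraction semigroup: `exp (-h T)` differs from `1 - h T` only by `o(h)`, and so is expanding up
to a factor `1 - o(h)`. -/
theorem norm_exp_smul_apply_le {T : SuperOp V}
    (hT : ∀ h : ℝ, 0 ≤ h → ∀ O : Op V, ‖O‖ ≤ ‖O - (h : ℂ) • T O‖) {t : ℝ} (ht : 0 ≤ t) (O : Op V) :
    ‖NormedSpace.exp ((t : ℂ) • T) O‖ ≤ ‖O‖ := by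
  have happ : ∀ (S : SuperOp V) (P : Op V), ‖S P‖ ≤ ‖S‖ * ‖P‖ :=
    fun S P => ContinuousLinearMap.le_opNorm (S : Op V →L[ℂ] Op V) P
  have key : ∀ ε : ℝ, 0 < ε → ‖NormedSpace.exp ((t : ℂ) • T) O‖ ≤ Real.exp (2 * ε * t) * ‖O‖ := by
    intro ε hε
    have hd := hasDerivAt_exp_smul_const (𝕂 := ℂ) T 0
    rw [zero_smul, NormedSpace.exp_zero, one_mul, hasDerivAt_iff_isLittleO] at hd
    have hd' := hd.bound hε
    rw [Metric.eventually_nhds_iff] at hd'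
    obtain ⟨δ, hδ, hδ'⟩ := hd'
    -- one short time step, compared with the resolvent by running the semigroup backwards
    have hstep : ∀ h : ℝ, 0 ≤ h → h < δ → ε * h ≤ 1 / 2 → ∀ P : Op V,
        ‖NormedSpace.exp ((h : ℂ) • T) P‖ ≤ Real.exp (2 * ε * h) * ‖P‖ := by
      intro h h0 h1 h2 P
      set Q := NormedSpace.exp ((h : ℂ) • T) P with hQ
      have hinv : NormedSpace.exp ((-h : ℂ) • T) Q = P := by
        rw [hQ, ← SuperOp.mul_apply, neg_smul, ← NormedSpace.exp_add_of_commute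
          (Commute.neg_left (Commute.refl _)), neg_add_cancel, NormedSpace.exp_zero,
          SuperOp.one_apply]
      have hbd := hδ' (y := (-h : ℂ)) (by simpa [abs_of_nonneg h0] using h1)
      rw [zero_smul, NormedSpace.exp_zero, sub_zero, norm_neg, Complex.norm_real,
        Real.norm_of_nonneg h0] at hbd
      have h3 : ‖Q - (h : ℂ) • T Q‖ ≤ ‖P‖ + ε * h * ‖Q‖ := by
        have heq : Q - (h : ℂ) • T Q
            = P - (NormedSpace.exp ((-h : ℂ) • T) - 1 - (-h : ℂ) • T) Q := by
          rw [SuperOp.sub_apply, SuperOp.sub_apply, SuperOp.smul_apply, SuperOp.one_apply, hinv,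
            neg_smul]
          abel
        rw [heq]
        refine (norm_sub_le _ _).trans (add_le_add le_rfl ((happ _ _).trans ?_))
        exact mul_le_mul_of_nonneg_right hbd (norm_nonneg _)
      have h4 := (hT h h0 Q).trans h3
      have h5 : (1 : ℝ) ≤ (1 + 2 * (ε * h)) * (1 - ε * h) := by nlinarith [mul_nonneg hε.le h0]
      have h6 : ‖Q‖ ≤ (1 + 2 * (ε * h)) * ‖P‖ := by
        have h7 : (1 - ε * h) * ‖Q‖ ≤ ‖P‖ := by linarith
        calc ‖Q‖ ≤ (1 + 2 * (ε * h)) * (1 - ε * h) * ‖Q‖ :=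
              le_mul_of_one_le_left (norm_nonneg _) h5
          _ = (1 + 2 * (ε * h)) * ((1 - ε * h) * ‖Q‖) := by ring
          _ ≤ _ := mul_le_mul_of_nonneg_left h7 (by nlinarith [mul_nonneg hε.le h0])
      refine h6.trans (mul_le_mul_of_nonneg_right ?_ (norm_nonneg _))
      have := Real.add_one_le_exp (2 * ε * h)
      linarith
    obtain ⟨n, hn⟩ := exists_nat_gt (max (t / δ) (2 * ε * t))
    have hn1 : t / δ < n := (le_max_left _ _).trans_lt hn
    have hn2 : 2 * ε * t < n := (le_max_right _ _).trans_lt hn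
    have hn0 : (0 : ℝ) < n := lt_of_le_of_lt (by positivity) hn1
    have hiter : ∀ m : ℕ, ‖(NormedSpace.exp (((t / n : ℝ) : ℂ) • T) ^ m) O‖
        ≤ Real.exp (2 * ε * (t / n)) ^ m * ‖O‖ := by
      intro m
      induction m with
      | zero => simp
      | succ m ih =>
        rw [pow_succ', SuperOp.mul_apply, pow_succ', mul_assoc]
        refine (hstep (t / n) (by positivity) ?_ ?_ _).trans
          (mul_le_mul_of_nonneg_left ih (Real.exp_pos _).le)
        · rw [div_lt_iff₀ hδ] at hn1
          rw [div_lt_iff₀ hn0]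
          linarith
        · rw [← mul_div_assoc, div_le_iff₀ hn0]
          linarith
    have h := hiter n
    rw [← NormedSpace.exp_nsmul, ← Real.exp_nat_mul] at h
    have e1 : n • (((t / n : ℝ) : ℂ) • T) = (t : ℂ) • T := by
      rw [← Nat.cast_smul_eq_nsmul ℂ, smul_smul]
      congr 1
      have : (n : ℂ) ≠ 0 := by exact_mod_cast hn0.ne'
      push_cast
      field_simp
    have e2 : (n : ℝ) * (2 * ε * (t / n)) = 2 * ε * t := by field_simp
    rwa [e1, e2] at h
  have hlim : Tendsto (fun ε : ℝ => Real.exp (2 * ε * t) * ‖O‖) (nhdsWithin 0 (Set.Ioi 0))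
      (nhds (Real.exp (2 * 0 * t) * ‖O‖)) :=
    Tendsto.mono_left (Continuous.tendsto (by fun_prop) 0) nhdsWithin_le_nhds
  rw [mul_zero, zero_mul, Real.exp_zero, one_mul] at hlim
  exact ge_of_tendsto hlim (eventually_nhdsWithin_of_forall fun ε hε => key ε hε)

/-- The Hilbert space of the qubits in `V`. -/
abbrev QubitSpace (V : Type) := EuclideanSpace ℂ (V → Fin 2)

/-- The rank one operator `w ↦ ⟪u, w⟫ v`. -/
def ketBra (v u : QubitSpace V) : Op V := Matrix.vecMulVec v.ofLp (star u.ofLp)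

theorem trace_mul_ketBra (M : Op V) (v u : QubitSpace V) :
    (M * ketBra v u).trace = inner ℂ u (Matrix.toEuclideanCLM (𝕜 := ℂ) M v) := by
  rw [ketBra, Matrix.mul_vecMulVec, Matrix.trace_vecMulVec, EuclideanSpace.inner_eq_star_dotProduct,
    Matrix.ofLp_toEuclideanCLM]

/-- An operator attains its norm at a pair of singular vectors. -/
theorem exists_singular_pair (O : Op V) : ∃ u v : QubitSpace V, ‖u‖ ≤ 1 ∧ ‖v‖ ≤ 1 ∧
    Matrix.toEuclideanCLM (𝕜 := ℂ) O v = (‖O‖ : ℂ) • u ∧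
    Matrix.toEuclideanCLM (𝕜 := ℂ) Oᴴ u = (‖O‖ : ℂ) • v ∧
    inner ℂ u (Matrix.toEuclideanCLM (𝕜 := ℂ) O v) = (‖O‖ : ℂ) := by
  set T := Matrix.toEuclideanCLM (n := V → Fin 2) (𝕜 := ℂ) O with hT
  have hTn : ‖T‖ = ‖O‖ := Matrix.l2_opNorm_toEuclideanCLM O
  have hTs : Matrix.toEuclideanCLM (𝕜 := ℂ) Oᴴ = ContinuousLinearMap.adjoint T := by
    rw [← ContinuousLinearMap.star_eq_adjoint, hT, ← map_star]
    rfl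
  rw [hTs, ← hTn]
  rcases eq_or_lt_of_le (norm_nonneg T) with h0 | hpos
  · refine ⟨0, 0, ?_⟩
    simp [← h0]
  -- the right singular vector maximizes `‖T w‖` on the unit ball
  obtain ⟨v, hv, hmax⟩ := (isCompact_closedBall (0 : QubitSpace V) 1).exists_isMaxOn
    ⟨0, by simp⟩ (f := fun w => ‖T w‖) (by fun_prop)
  have hv1 : ‖v‖ ≤ 1 := by simpa using hv
  have hle : ‖T‖ ≤ ‖T v‖ := by
    refine T.opNorm_le_bound (norm_nonneg _) fun w => ?_
    rcases eq_or_ne w 0 with rfl | hw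
    · simp
    have hw' : 0 < ‖w‖ := norm_pos_iff.2 hw
    have hmem : ((‖w‖⁻¹ : ℝ) : ℂ) • w ∈ Metric.closedBall (0 : QubitSpace V) 1 := by
      simp [norm_smul, hw'.ne']
    have h := hmax hmem
    simp only [Set.mem_ofPred_eq, map_smul, norm_smul, Complex.norm_real, norm_inv, norm_norm] at h
    rwa [inv_mul_le_iff₀ hw', mul_comm] at h
  have heq : ‖T v‖ = ‖T‖ := le_antisymm
    ((T.le_opNorm v).trans (mul_le_of_le_one_right (norm_nonneg _) hv1)) hle
  set u : QubitSpace V := ((‖T‖⁻¹ : ℝ) : ℂ) • T v with hu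
  have hTv : T v = (‖T‖ : ℂ) • u := by
    rw [hu, smul_smul, ← Complex.ofReal_mul, mul_inv_cancel₀ hpos.ne', Complex.ofReal_one, one_smul]
  have hu1 : ‖u‖ = 1 := by
    rw [hu, norm_smul, heq, Complex.norm_real, norm_inv, norm_norm, inv_mul_cancel₀ hpos.ne']
  have hinner : inner ℂ u (T v) = (‖T‖ : ℂ) := by
    rw [hTv, inner_smul_right, inner_self_eq_norm_sq_to_K, hu1]
    simp
  refine ⟨u, v, hu1.le, hv1, hTv, ?_, hinner⟩
  have hadj : ‖ContinuousLinearMap.adjoint T u‖ ≤ ‖T‖ := by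
    refine (ContinuousLinearMap.le_opNorm _ u).trans ?_
    rw [hu1, mul_one, LinearIsometryEquiv.norm_map]
  -- the equality case of the Cauchy-Schwarz inequality
  have hzero : ‖ContinuousLinearMap.adjoint T u - (‖T‖ : ℂ) • v‖ ^ 2 ≤ 0 := by
    rw [@norm_sub_sq ℂ, inner_smul_right, ContinuousLinearMap.adjoint_inner_left, hinner, norm_smul,
      Complex.norm_real, norm_norm]
    have h1 : RCLike.re ((‖T‖ : ℂ) * ‖T‖) = ‖T‖ * ‖T‖ := by
      rw [← Complex.ofReal_mul]; exact Complex.ofReal_re _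
    rw [h1]
    have h2 := pow_le_pow_left₀ (norm_nonneg _) hadj 2
    have h3 : (‖T‖ * ‖v‖) ^ 2 ≤ ‖T‖ ^ 2 :=
      pow_le_pow_left₀ (by positivity) (mul_le_of_le_one_right (norm_nonneg _) hv1) 2
    nlinarith
  exact sub_eq_zero.1 (norm_eq_zero.1 (pow_eq_zero_iff two_ne_zero |>.1
    (le_antisymm hzero (sq_nonneg _))))

/-- Dissipativity of a generator for the operator norm in the Heisenberg picture, tested on
singular vectors `u`, `v` of the observable. The condition is linear in the generator, so it passes
to sums and integrals. -/
def IsDissipative (S : SuperOp V) : Prop :=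
  ∀ (O : Op V) (u v : QubitSpace V),
    Matrix.toEuclideanCLM (𝕜 := ℂ) O v = (‖O‖ : ℂ) • u →
    Matrix.toEuclideanCLM (𝕜 := ℂ) Oᴴ u = (‖O‖ : ℂ) • v → ((O * S (ketBra v u)).trace).re ≤ 0

theorem IsDissipative.norm_exp_heisenberg_le {S : SuperOp V} (hS : IsDissipative S) {t : ℝ}
    (ht : 0 ≤ t) (O : Op V) : ‖heisenberg (NormedSpace.exp ((t : ℂ) • S)) O‖ ≤ ‖O‖ := by
  rw [heisenberg_exp, heisenberg_smul]
  refine norm_exp_smul_apply_le (fun h h0 O => ?_) ht O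
  obtain ⟨u, v, hu, hv, h1, h2, h3⟩ := exists_singular_pair O
  have h4 := hS O u v h1 h2
  rw [← trace_heisenberg_mul, trace_mul_ketBra] at h4
  set M := O - (h : ℂ) • heisenberg S O with hM
  have h5 : (inner ℂ u (Matrix.toEuclideanCLM (𝕜 := ℂ) M v)).re
      = ‖O‖ - h * (inner ℂ u (Matrix.toEuclideanCLM (𝕜 := ℂ) (heisenberg S O) v)).re := by
    rw [hM, map_sub, map_smul, _root_.sub_apply, _root_.smul_apply,
      inner_sub_right, inner_smul_right, h3, Complex.sub_re, Complex.re_ofReal_mul,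
      Complex.ofReal_re]
  have h6 : (inner ℂ u (Matrix.toEuclideanCLM (𝕜 := ℂ) M v)).re ≤ ‖M‖ := by
    refine (Complex.re_le_norm _).trans ((norm_inner_le_norm _ _).trans ?_)
    have h7 := (Matrix.toEuclideanCLM (𝕜 := ℂ) M).le_opNorm v
    rw [Matrix.l2_opNorm_toEuclideanCLM] at h7
    have h8 := mul_le_mul hu (h7.trans (mul_le_of_le_one_right (norm_nonneg M) hv))
      (norm_nonneg _) zero_le_one
    rwa [one_mul] at h8
  nlinarith

end Contraction

section Dissipativity

set_option linter.unusedSectionVars false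

variable {V : Type} [Fintype V] [DecidableEq V]

/-- The functional `S ↦ trace (O * S X)` on superoperators. -/
def pairingCLM (O X : Op V) : SuperOp V →L[ℂ] ℂ :=
  (LinearMap.toContinuousLinearMap
    ((Matrix.traceLinearMap (V → Fin 2) ℂ ℂ).comp (LinearMap.mulLeft ℂ O))).comp (evalCLM X)

theorem pairingCLM_apply (O X : Op V) (S : SuperOp V) : pairingCLM O X S = (O * S X).trace := rfl

theorem IsDissipative.add {S T : SuperOp V} (hS : IsDissipative S) (hT : IsDissipative T) :
    IsDissipative (S + T) := fun O u v h1 h2 => by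
  rw [SuperOp.add_apply, mul_add, Matrix.trace_add, Complex.add_re]
  exact add_nonpos (hS O u v h1 h2) (hT O u v h1 h2)

theorem IsDissipative.sum {ι : Type*} {s : Finset ι} {S : ι → SuperOp V}
    (hS : ∀ i ∈ s, IsDissipative (S i)) : IsDissipative (∑ i ∈ s, S i) := fun O u v h1 h2 => by
  rw [← pairingCLM_apply, map_sum, Complex.re_sum]
  exact Finset.sum_nonpos fun i hi => hS i hi O u v h1 h2

theorem IsDissipative.integral {w : ℝ → ℝ} {S : ℝ → SuperOp V} (hw : ∀ ω, 0 ≤ w ω)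
    (hS : ∀ ω, IsDissipative (S ω)) (hint : Integrable fun ω => (w ω : ℂ) • S ω) :
    IsDissipative (∫ ω, (w ω : ℂ) • S ω) := fun O u v h1 h2 => by
  rw [← pairingCLM_apply, ← (pairingCLM O (ketBra v u)).integral_comp_comm hint]
  have h := Complex.reCLM.integral_comp_comm
    ((pairingCLM O (ketBra v u)).integrable_comp hint)
  simp only [Complex.reCLM_apply] at h
  rw [← h]
  refine integral_nonpos fun ω => ?_
  rw [map_smul, smul_eq_mul, Complex.re_ofReal_mul, pairingCLM_apply]
  exact mul_nonpos_of_nonneg_of_nonpos (hw ω) (hS ω O u v h1 h2)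

theorem toEuclideanCLM_mul_apply (A B : Op V) (v : QubitSpace V) :
    Matrix.toEuclideanCLM (𝕜 := ℂ) (A * B) v
      = Matrix.toEuclideanCLM (𝕜 := ℂ) A (Matrix.toEuclideanCLM (𝕜 := ℂ) B v) := by
  rw [map_mul]
  rfl

theorem inner_toEuclideanCLM_conjTranspose (A : Op V) (u v : QubitSpace V) :
    inner ℂ u (Matrix.toEuclideanCLM (𝕜 := ℂ) Aᴴ v)
      = inner ℂ (Matrix.toEuclideanCLM (𝕜 := ℂ) A u) v := by
  have h : Matrix.toEuclideanCLM (𝕜 := ℂ) Aᴴ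
      = ContinuousLinearMap.adjoint (Matrix.toEuclideanCLM (𝕜 := ℂ) A) := by
    rw [← ContinuousLinearMap.star_eq_adjoint, ← map_star]
    rfl
  rw [h, ContinuousLinearMap.adjoint_inner_right]

theorem inner_toEuclideanCLM_of_adjoint {O : Op V} {u v : QubitSpace V} {c : ℝ}
    (h : Matrix.toEuclideanCLM (𝕜 := ℂ) Oᴴ u = (c : ℂ) • v) (w : QubitSpace V) :
    inner ℂ u (Matrix.toEuclideanCLM (𝕜 := ℂ) O w) = c * inner ℂ v w := by
  have h1 := inner_toEuclideanCLM_conjTranspose Oᴴ u w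
  rw [Matrix.conjTranspose_conjTranspose, h, inner_smul_left, Complex.conj_ofReal] at h1
  exact h1

theorem inner_self_eq_ofReal (w : QubitSpace V) : inner ℂ w w = ((‖w‖ ^ 2 : ℝ) : ℂ) := by
  rw [inner_self_eq_norm_sq_to_K]
  push_cast
  rfl

/-- For singular vectors, both terms of the commutator are `‖O‖` times expectations of `B`, which are
real. -/
theorem isDissipative_commutator {B : Op V} (hB : B.IsHermitian) :
    IsDissipative ((-Complex.I) • commutator B) := fun O u v h1 h2 => by
  have hreal : ∀ w : QubitSpace V, (inner ℂ w (Matrix.toEuclideanCLM (𝕜 := ℂ) B w)).im = 0 := by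
    intro w
    have h := inner_toEuclideanCLM_conjTranspose B w w
    rw [hB.eq] at h
    exact Complex.conj_eq_iff_im.1 ((inner_conj_symm _ _).trans h.symm)
  rw [SuperOp.smul_apply, commutator_apply, Matrix.mul_smul, Matrix.trace_smul, mul_sub,
    Matrix.trace_sub, ← mul_assoc, ← mul_assoc, Matrix.trace_mul_comm (O * ketBra v u), ← mul_assoc,
    trace_mul_ketBra, trace_mul_ketBra, toEuclideanCLM_mul_apply, toEuclideanCLM_mul_apply,
    inner_toEuclideanCLM_of_adjoint h2, h1, map_smul, inner_smul_right, ← mul_sub, smul_eq_mul,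
    neg_mul, Complex.neg_re, Complex.I_mul_re, Complex.im_ofReal_mul, Complex.sub_im, hreal, hreal]
  simp

/-- The gain term is at most `‖O‖ * ‖K u‖ * ‖K v‖`, and the loss term is `‖O‖` times the mean of
`‖K u‖ ^ 2` and `‖K v‖ ^ 2`. -/
theorem isDissipative_dissipator (K : Op V) : IsDissipative (dissipator K) := fun O u v h1 h2 => by
  set Ku := Matrix.toEuclideanCLM (𝕜 := ℂ) K u with hKu
  set Kv := Matrix.toEuclideanCLM (𝕜 := ℂ) K v with hKv
  have e1 : (O * (K * ketBra v u * Kᴴ)).trace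
      = inner ℂ Ku (Matrix.toEuclideanCLM (𝕜 := ℂ) O Kv) := by
    rw [← mul_assoc, ← mul_assoc, Matrix.trace_mul_comm, ← mul_assoc, trace_mul_ketBra,
      toEuclideanCLM_mul_apply, inner_toEuclideanCLM_conjTranspose, toEuclideanCLM_mul_apply]
  have e2 : (O * (Kᴴ * K * ketBra v u)).trace = ‖O‖ * inner ℂ Kv Kv := by
    rw [← mul_assoc, trace_mul_ketBra, toEuclideanCLM_mul_apply,
      inner_toEuclideanCLM_of_adjoint h2, toEuclideanCLM_mul_apply,
      inner_toEuclideanCLM_conjTranspose]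
  have e3 : (O * (ketBra v u * (Kᴴ * K))).trace = ‖O‖ * inner ℂ Ku Ku := by
    rw [← mul_assoc, Matrix.trace_mul_comm, ← mul_assoc, trace_mul_ketBra,
      toEuclideanCLM_mul_apply, h1, map_smul, inner_smul_right, toEuclideanCLM_mul_apply,
      inner_toEuclideanCLM_conjTranspose]
  have e4 : (inner ℂ Ku (Matrix.toEuclideanCLM (𝕜 := ℂ) O Kv)).re ≤ ‖Ku‖ * (‖O‖ * ‖Kv‖) := by
    refine (Complex.re_le_norm _).trans ((norm_inner_le_norm _ _).trans ?_)
    have h := (Matrix.toEuclideanCLM (𝕜 := ℂ) O).le_opNorm Kv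
    rw [Matrix.l2_opNorm_toEuclideanCLM] at h
    exact mul_le_mul_of_nonneg_left h (norm_nonneg _)
  rw [dissipator_apply, mul_sub, Matrix.trace_sub, Matrix.mul_smul, Matrix.trace_smul, mul_add,
    Matrix.trace_add, e1, e2, e3, inner_self_eq_ofReal, inner_self_eq_ofReal,
    Complex.sub_re, show (1 / 2 : ℂ) • ((‖O‖ : ℂ) * ((‖Kv‖ ^ 2 : ℝ) : ℂ)
        + (‖O‖ : ℂ) * ((‖Ku‖ ^ 2 : ℝ) : ℂ))
      = ((‖O‖ * (‖Kv‖ ^ 2 + ‖Ku‖ ^ 2) / 2 : ℝ) : ℂ) by push_cast; rw [smul_eq_mul]; ring,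
    Complex.ofReal_re]
  nlinarith [mul_nonneg (norm_nonneg O) (sq_nonneg (‖Ku‖ - ‖Kv‖))]

/-- The Gibbs sampler of a diagonal Hamiltonian generates a contraction semigroup in the Heisenberg
picture. -/
theorem isDissipative_gibbsSampler {β : ℝ} (hβ : 0 < β) (E : (V → Fin 2) → ℝ) {J : ℕ}
    {A : Fin J → Op V} (hA : ∀ a, ‖A a‖ ≤ 1) :
    IsDissipative (gibbsSampler β (classicalHamiltonian E) A) := by
  refine (isDissipative_commutator ?_).add (IsDissipative.sum fun a _ => ?_)
  · rw [Matrix.IsHermitian, Matrix.conjTranspose_sum]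
    exact Finset.sum_congr rfl fun a _ => isHermitian_coherentTerm E (A a)
  · exact IsDissipative.integral (transitionWeight_nonneg β)
      (fun ω => isDissipative_dissipator _) (integrable_dissipator E hβ (hA a))

theorem norm_apply_self_le (M : Op V) (x : V → Fin 2) : ‖M x x‖ ≤ ‖M‖ := by
  have h1 : M x x = inner ℂ (EuclideanSpace.single x (1 : ℂ))
      (Matrix.toEuclideanCLM (𝕜 := ℂ) M (EuclideanSpace.single x 1)) := by
    rw [EuclideanSpace.inner_single_left, Matrix.ofLp_toEuclideanCLM]
    simp
  rw [h1]
  refine (norm_inner_le_norm _ _).trans ?_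
  have h := (Matrix.toEuclideanCLM (𝕜 := ℂ) M).le_opNorm (EuclideanSpace.single x 1)
  rw [Matrix.l2_opNorm_toEuclideanCLM] at h
  simpa using h

theorem trace_mul_single_self (M : Op V) (x : V → Fin 2) :
    (M * Matrix.single x x 1).trace = M x x := by
  simp [Matrix.trace_mul_single]

theorem norm_trace_dissipator_single_le (K O : Op V) (x : V → Fin 2) :
    ‖(O * dissipator K (Matrix.single x x 1)).trace‖ ≤ 2 * ‖K‖ ^ 2 * ‖O‖ := by
  have hK : ‖Kᴴ‖ = ‖K‖ := Matrix.l2_opNorm_conjTranspose K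
  have hKK : ‖Kᴴ * K‖ ≤ ‖K‖ ^ 2 := by
    refine (norm_mul_le _ _).trans_eq ?_
    rw [hK, sq]
  have e1 : ‖(O * (K * Matrix.single x x 1 * Kᴴ)).trace‖ ≤ ‖K‖ ^ 2 * ‖O‖ := by
    rw [← mul_assoc, ← mul_assoc, Matrix.trace_mul_comm, ← mul_assoc, trace_mul_single_self]
    refine (norm_apply_self_le _ _).trans ((norm_mul_le _ _).trans
      ((mul_le_mul_of_nonneg_left (norm_mul_le _ _) (norm_nonneg _)).trans_eq ?_))
    rw [hK]
    ring
  have e2 : ‖(O * (Kᴴ * K * Matrix.single x x 1)).trace‖ ≤ ‖K‖ ^ 2 * ‖O‖ := by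
    rw [← mul_assoc, trace_mul_single_self, mul_comm (‖K‖ ^ 2)]
    exact (norm_apply_self_le _ _).trans ((norm_mul_le _ _).trans
      (mul_le_mul_of_nonneg_left hKK (norm_nonneg _)))
  have e3 : ‖(O * (Matrix.single x x 1 * (Kᴴ * K))).trace‖ ≤ ‖K‖ ^ 2 * ‖O‖ := by
    rw [← mul_assoc, Matrix.trace_mul_comm, ← mul_assoc, trace_mul_single_self]
    exact (norm_apply_self_le _ _).trans ((norm_mul_le _ _).trans
      (mul_le_mul_of_nonneg_right hKK (norm_nonneg _)))
  rw [dissipator_apply, mul_sub, Matrix.trace_sub, Matrix.mul_smul, Matrix.trace_smul, mul_add,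
    Matrix.trace_add]
  refine (norm_sub_le _ _).trans ?_
  rw [norm_smul, show ‖(1 / 2 : ℂ)‖ = 1 / 2 by norm_num]
  have := norm_add_le (O * (Kᴴ * K * Matrix.single x x 1)).trace
    (O * (Matrix.single x x 1 * (Kᴴ * K))).trace
  linarith

theorem norm_trace_commutator_single_le (B O : Op V) (x : V → Fin 2) :
    ‖(O * commutator B (Matrix.single x x 1)).trace‖ ≤ 2 * ‖B‖ * ‖O‖ := by
  rw [commutator_apply, mul_sub, Matrix.trace_sub, ← mul_assoc, ← mul_assoc,
    Matrix.trace_mul_comm (O * Matrix.single x x 1), ← mul_assoc, trace_mul_single_self,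
    trace_mul_single_self]
  have h1 := (norm_apply_self_le (O * B) x).trans (norm_mul_le _ _)
  have h2 := (norm_apply_self_le (B * O) x).trans (norm_mul_le _ _)
  refine (norm_sub_le _ _).trans ?_
  linarith

/-- A bound, depending on the inverse temperature only, on the rate that one jump operator of norm
at most `1` contributes to the Gibbs sampler. -/
def rateBound (β : ℝ) : ℝ :=
  2 * ((∫ t, |coherentWeight₁ t|) * ∫ t, ‖coherentWeight₂ t‖)
    + (∫ ω, transitionWeight β ω) * (2 * jumpBound β ^ 2)

theorem rateBound_nonneg (β : ℝ) : 0 ≤ rateBound β := by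
  have h1 : 0 ≤ ∫ ω, transitionWeight β ω := integral_nonneg fun ω => transitionWeight_nonneg β ω
  have h2 : 0 ≤ (∫ t, |coherentWeight₁ t|) * ∫ t, ‖coherentWeight₂ t‖ :=
    mul_nonneg (integral_nonneg fun _ => abs_nonneg _) (integral_nonneg fun _ => norm_nonneg _)
  rw [rateBound]
  positivity

theorem norm_trace_gibbsSampler_single_le {β : ℝ} (hβ : 0 < β) (E : (V → Fin 2) → ℝ) {J : ℕ}
    {A : Fin J → Op V} (hA : ∀ a, ‖A a‖ ≤ 1) (O : Op V) (x : V → Fin 2) :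
    ‖(O * gibbsSampler β (classicalHamiltonian E) A (Matrix.single x x 1)).trace‖
      ≤ J * rateBound β * ‖O‖ := by
  set b := (∫ t, |coherentWeight₁ t|) * ∫ t, ‖coherentWeight₂ t‖ with hb
  have hb0 : 0 ≤ b := mul_nonneg (integral_nonneg fun _ => abs_nonneg _)
    (integral_nonneg fun _ => norm_nonneg _)
  have hB : ‖∑ a, coherentTerm β (classicalHamiltonian E) (A a)‖ ≤ J * b := by
    refine (norm_sum_le _ _).trans ?_
    have h : ∀ a ∈ Finset.univ, ‖coherentTerm β (classicalHamiltonian E) (A a)‖ ≤ b := by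
      intro a _
      refine (norm_coherentTerm_le E (A a)).trans ?_
      rw [← mul_assoc]
      exact mul_le_of_le_one_right hb0 (pow_le_one₀ (norm_nonneg _) (hA a))
    simpa using Finset.sum_le_card_nsmul _ _ _ h
  have hD : ∀ a, ‖pairingCLM O (Matrix.single x x 1) (∫ ω, (transitionWeight β ω : ℂ) •
      dissipator (fourierJump β (classicalHamiltonian E) (A a) ω))‖
      ≤ (∫ ω, transitionWeight β ω) * (2 * jumpBound β ^ 2) * ‖O‖ := by
    intro a
    rw [← (pairingCLM O (Matrix.single x x 1)).integral_comp_comm (integrable_dissipator E hβ (hA a)),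
      mul_assoc, ← integral_mul_const]
    refine norm_integral_le_of_norm_le ((integrable_transitionWeight hβ).mul_const _)
      (Eventually.of_forall fun ω => ?_)
    rw [map_smul, norm_smul, Complex.norm_real, Real.norm_of_nonneg (transitionWeight_nonneg β ω),
      pairingCLM_apply]
    refine mul_le_mul_of_nonneg_left ((norm_trace_dissipator_single_le _ _ _).trans ?_)
      (transitionWeight_nonneg β ω)
    refine mul_le_mul_of_nonneg_right (mul_le_mul_of_nonneg_left
      (pow_le_pow_left₀ (norm_nonneg _) (norm_fourierJump_le_jumpBound E hβ (hA a) ω) 2)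
      zero_le_two) (norm_nonneg _)
  have hsum : pairingCLM O (Matrix.single x x 1) (gibbsSampler β (classicalHamiltonian E) A)
      = -Complex.I * pairingCLM O (Matrix.single x x 1)
          (commutator (∑ a, coherentTerm β (classicalHamiltonian E) (A a)))
        + ∑ a, pairingCLM O (Matrix.single x x 1) (∫ ω, (transitionWeight β ω : ℂ) •
            dissipator (fourierJump β (classicalHamiltonian E) (A a) ω)) := by
    rw [gibbsSampler, map_add, map_smul, map_sum, smul_eq_mul]
  rw [← pairingCLM_apply, hsum]
  refine (norm_add_le _ _).trans ?_
  have h1 : ‖-Complex.I * pairingCLM O (Matrix.single x x 1)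
      (commutator (∑ a, coherentTerm β (classicalHamiltonian E) (A a)))‖ ≤ 2 * (J * b) * ‖O‖ := by
    rw [norm_mul, norm_neg, Complex.norm_I, one_mul, pairingCLM_apply]
    exact (norm_trace_commutator_single_le _ _ _).trans
      (mul_le_mul_of_nonneg_right (mul_le_mul_of_nonneg_left hB zero_le_two) (norm_nonneg _))
  have h2 : ‖∑ a, pairingCLM O (Matrix.single x x 1) (∫ ω, (transitionWeight β ω : ℂ) •
      dissipator (fourierJump β (classicalHamiltonian E) (A a) ω))‖
      ≤ J * ((∫ ω, transitionWeight β ω) * (2 * jumpBound β ^ 2) * ‖O‖) := by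
    refine (norm_sum_le _ _).trans ?_
    simpa using Finset.sum_le_card_nsmul Finset.univ _ _ fun a _ => hD a
  refine (add_le_add h1 h2).trans_eq ?_
  rw [rateBound]
  ring

end Dissipativity

/-! ### The trace norm -/

section TraceNorm

set_option linter.unusedSectionVars false

variable {V : Type} [Fintype V] [DecidableEq V]

/-- The duality between the trace norm and the operator norm, proved by evaluating the trace in an
eigenbasis of `Yᴴ * Y`. -/
theorem norm_trace_mul_le_mul_traceNorm (O Y : Op V) : ‖(O * Y).trace‖ ≤ ‖O‖ * traceNorm Y := by
  set hY := Matrix.isHermitian_conjTranspose_mul_self Y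
  set e := hY.eigenvectorBasis
  have htr : (O * Y).trace
      = ∑ i, inner ℂ (e i) (Matrix.toEuclideanCLM (𝕜 := ℂ) (O * Y) (e i)) := by
    set T := (Matrix.toEuclideanCLM (n := V → Fin 2) (𝕜 := ℂ) (O * Y)).toLinearMap
    have h1 := LinearMap.trace_eq_sum_inner T e
    have h2 := LinearMap.trace_eq_sum_inner T (EuclideanSpace.basisFun (V → Fin 2) ℂ)
    refine Eq.trans ?_ (h2.symm.trans h1)
    refine Finset.sum_congr rfl fun x _ => ?_
    rw [EuclideanSpace.basisFun_apply, EuclideanSpace.inner_single_left]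
    simp [T]
    rfl
  rw [htr, traceNorm, Finset.mul_sum]
  refine (norm_sum_le _ _).trans (Finset.sum_le_sum fun i _ => ?_)
  have hnorm : ‖Matrix.toEuclideanCLM (𝕜 := ℂ) Y (e i)‖ = Real.sqrt (hY.eigenvalues i) := by
    rw [← Real.sqrt_sq (norm_nonneg _)]
    congr 1
    have h : Matrix.toEuclideanCLM (𝕜 := ℂ) (Yᴴ * Y) (e i) = (hY.eigenvalues i : ℂ) • e i := by
      have := hY.mulVec_eigenvectorBasis i
      ext x
      exact congrFun this x
    have h' := inner_toEuclideanCLM_conjTranspose Y (e i) (Matrix.toEuclideanCLM (𝕜 := ℂ) Y (e i))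
    rw [← toEuclideanCLM_mul_apply, h, inner_smul_right, inner_self_eq_ofReal,
      inner_self_eq_ofReal, e.norm_eq_one] at h'
    have h'' := congrArg Complex.re h'
    rw [Complex.ofReal_re, Complex.re_ofReal_mul, Complex.ofReal_re] at h''
    simpa using h''.symm
  refine (norm_inner_le_norm _ _).trans ?_
  rw [e.norm_eq_one, one_mul, toEuclideanCLM_mul_apply, ← hnorm]
  have h := (Matrix.toEuclideanCLM (𝕜 := ℂ) O).le_opNorm (Matrix.toEuclideanCLM (𝕜 := ℂ) Y (e i))
  rwa [Matrix.l2_opNorm_toEuclideanCLM] at h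

theorem roots_charpoly_diagonal (c : (V → Fin 2) → ℂ) :
    (Matrix.diagonal c).charpoly.roots = Multiset.map c Finset.univ.val := by
  rw [Matrix.charpoly_diagonal, Polynomial.roots_prod]
  · simp
  · simp [Finset.prod_ne_zero_iff, Polynomial.X_sub_C_ne_zero]

theorem traceNorm_diagonal (d : (V → Fin 2) → ℂ) :
    traceNorm (Matrix.diagonal d : Op V) = ∑ x, ‖d x‖ := by
  set hd := Matrix.isHermitian_conjTranspose_mul_self (Matrix.diagonal d : Op V)
  have h1 := hd.roots_charpoly_eq_eigenvalues
  have h2 : (Matrix.diagonal d : Op V)ᴴ * Matrix.diagonal d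
      = Matrix.diagonal fun x => ((‖d x‖ ^ 2 : ℝ) : ℂ) := by
    rw [Matrix.diagonal_conjTranspose, Matrix.diagonal_mul_diagonal]
    congr 1
    ext x
    rw [Pi.star_apply, Complex.star_def, Complex.conj_mul']
    norm_cast
  have h3 : ((Matrix.diagonal d : Op V)ᴴ * Matrix.diagonal d).charpoly.roots
      = Multiset.map (fun x => ((‖d x‖ ^ 2 : ℝ) : ℂ)) Finset.univ.val := by
    rw [h2, roots_charpoly_diagonal]
  rw [h3] at h1
  have h4 := congrArg (fun s => (s.map fun z : ℂ => Real.sqrt z.re).sum) h1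
  simp only [Multiset.map_map, Function.comp_def] at h4
  rw [traceNorm]
  refine Eq.trans ?_ (h4.symm.trans ?_)
  · exact Finset.sum_congr rfl fun x _ => rfl
  · refine Finset.sum_congr rfl fun x _ => ?_
    rw [Complex.ofReal_re, Real.sqrt_sq (norm_nonneg _)]

end TraceNorm

/-! ### The bottleneck bound -/

section Bottleneck

set_option linter.unusedSectionVars false

variable {V : Type} [Fintype V] [DecidableEq V]

/-- The part of the diagonal operator `p` that lives on the configurations satisfying `P`. -/
def restrictedDiagonal (p : (V → Fin 2) → ℂ) (P : (V → Fin 2) → Prop) [DecidablePred P] : Op V :=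
  Matrix.diagonal fun x => if P x then p x else 0

variable {β : ℝ} (E : (V → Fin 2) → ℝ) {J : ℕ} {A : Fin J → Op V} {s : (V → Fin 2) → ℤ} {κ : ℤ}

/-- If every jump operator changes the statistic `s` by at most `κ`, then the Gibbs sampler maps a
diagonal operator to one that is supported within distance `2 * κ` of it. -/
theorem gibbsSampler_diagonal_apply_eq_zero (hβ : 0 < β) (hA : ∀ a, ‖A a‖ ≤ 1)
    (hs : ∀ a x y, A a x y ≠ 0 → |s x - s y| ≤ κ) (q : (V → Fin 2) → ℂ) (x y : V → Fin 2)
    (hq : ∀ w, |s x - s w| ≤ 2 * κ → |s y - s w| ≤ 2 * κ → q w = 0) :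
    gibbsSampler β (classicalHamiltonian E) A (Matrix.diagonal q) x y = 0 := by
  rw [gibbsSampler_diagonal_apply E hβ hA]
  refine Finset.sum_eq_zero fun a _ => Finset.sum_eq_zero fun z _ => ?_
  have h1 : A a x z * q z * star (A a y z) = 0 := by
    by_contra h
    have hx := hs a x z fun h0 => h (by rw [h0]; ring)
    have hy := hs a y z fun h0 => h (by rw [h0]; simp)
    have hκ := (abs_nonneg _).trans hx
    exact h (by rw [hq z (by linarith) (by linarith)]; ring)
  by_cases h2 : star (A a z x) * A a z y = 0
  · rw [h1, h2]
    ring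
  have hx := hs a z x fun h0 => h2 (by rw [h0]; simp)
  have hy := hs a z y fun h0 => h2 (by rw [h0]; ring)
  have hκ := (abs_nonneg _).trans hx
  have hxy : |s x - s y| ≤ 2 * κ := by
    rw [abs_le] at hx hy ⊢
    constructor <;> linarith [hx.1, hx.2, hy.1, hy.2]
  have hqx : q x = 0 := hq x (by simpa using hκ) (by rwa [abs_sub_comm])
  have hqy : q y = 0 := hq y hxy (by simpa using hκ)
  rw [h1, hqx, hqy]
  ring

/-- The probability current out of `{s > 2κ}` is determined by the bottleneck `{|s| ≤ 2κ}`: as the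
weights `p` are stationary, `L` applied to the part of `p` on `{s > 2κ}` is cancelled by `L` applied
to the rest, and the part on `{s < -2κ}` is too far away to contribute. -/
theorem gibbsSampler_restrictedDiagonal (hβ : 0 < β) (hA : ∀ a, ‖A a‖ ≤ 1)
    (hs : ∀ a x y, A a x y ≠ 0 → |s x - s y| ≤ κ) {p : (V → Fin 2) → ℂ}
    (hp : gibbsSampler β (classicalHamiltonian E) A (Matrix.diagonal p) = 0) :
    gibbsSampler β (classicalHamiltonian E) A (restrictedDiagonal p fun x => 2 * κ < s x)
      = -(Matrix.diagonal (fun x => if 0 < s x then 1 else 0)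
        * gibbsSampler β (classicalHamiltonian E) A (restrictedDiagonal p fun x => |s x| ≤ 2 * κ)
        * Matrix.diagonal fun x => if 0 < s x then 1 else 0) := by
  have hsplit : (Matrix.diagonal p : Op V) = restrictedDiagonal p (fun x => 2 * κ < s x)
      + restrictedDiagonal p (fun x => |s x| ≤ 2 * κ)
      + restrictedDiagonal p (fun x => ¬ 2 * κ < s x ∧ ¬ |s x| ≤ 2 * κ) := by
    rw [restrictedDiagonal, restrictedDiagonal, restrictedDiagonal, Matrix.diagonal_add,
      Matrix.diagonal_add]
    congr 1
    ext x
    by_cases h1 : 2 * κ < s x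
    · have h2 : ¬ |s x| ≤ 2 * κ := fun h => absurd ((le_abs_self _).trans h) (not_le.2 h1)
      simp [h1, h2]
    · by_cases h2 : |s x| ≤ 2 * κ <;> simp [h1, h2]
  rw [hsplit, map_add, map_add] at hp
  ext x y
  rw [Matrix.neg_apply, Matrix.mul_diagonal, Matrix.diagonal_mul]
  by_cases hxy : 0 < s x ∧ 0 < s y
  · have h3 : gibbsSampler β (classicalHamiltonian E) A
        (restrictedDiagonal p fun x => ¬ 2 * κ < s x ∧ ¬ |s x| ≤ 2 * κ) x y = 0 := by
      refine gibbsSampler_diagonal_apply_eq_zero E hβ hA hs _ x y fun w hw _ => if_neg ?_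
      rintro ⟨h4, h5⟩
      rw [abs_le] at hw h5
      exact h5 ⟨by linarith [hw.2, hxy.1], not_lt.1 h4⟩
    have h := congrFun (congrFun hp x) y
    rw [Matrix.add_apply, Matrix.add_apply, h3, add_zero, Matrix.zero_apply] at h
    rw [if_pos hxy.1, if_pos hxy.2, one_mul, mul_one]
    exact eq_neg_of_add_eq_zero_left h
  · have h3 : gibbsSampler β (classicalHamiltonian E) A
        (restrictedDiagonal p fun x => 2 * κ < s x) x y = 0 := by
      refine gibbsSampler_diagonal_apply_eq_zero E hβ hA hs _ x y fun w hw hw' => if_neg ?_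
      intro h4
      rw [abs_le] at hw hw'
      exact hxy ⟨by linarith [hw.1], by linarith [hw'.1]⟩
    rw [h3]
    rcases not_and_or.1 hxy with h | h <;> simp [h]

theorem norm_trace_gibbsSampler_diagonal_le (hβ : 0 < β) (hA : ∀ a, ‖A a‖ ≤ 1)
    (q : (V → Fin 2) → ℂ) (O : Op V) :
    ‖(O * gibbsSampler β (classicalHamiltonian E) A (Matrix.diagonal q)).trace‖
      ≤ J * rateBound β * ‖O‖ * ∑ x, ‖q x‖ := by
  have hq : (Matrix.diagonal q : Op V) = ∑ x, q x • Matrix.single x x 1 := by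
    rw [← Matrix.sum_single_eq_diagonal]
    simp [Matrix.smul_single]
  rw [hq, map_sum, Finset.mul_sum, Matrix.trace_sum, Finset.mul_sum]
  refine (norm_sum_le _ _).trans (Finset.sum_le_sum fun x _ => ?_)
  rw [map_smul, Matrix.mul_smul, Matrix.trace_smul, norm_smul, mul_comm]
  exact mul_le_mul_of_nonneg_right (norm_trace_gibbsSampler_single_le hβ E hA O x) (norm_nonneg _)

theorem norm_diagonal_le_one {d : (V → Fin 2) → ℂ} (hd : ∀ x, ‖d x‖ ≤ 1) :
    ‖(Matrix.diagonal d : Op V)‖ ≤ 1 := by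
  rw [Matrix.l2_opNorm_diagonal]
  exact (pi_norm_le_iff_of_nonneg zero_le_one).2 hd

/-- The flow of probability out of `{s > 2κ}` is bounded at all times by the weight of the
bottleneck: contractivity in the Heisenberg picture moves the time evolution to the observable `O`
without increasing its norm. -/
theorem norm_trace_exp_gibbsSampler_restrictedDiagonal_le (hβ : 0 < β) (hA : ∀ a, ‖A a‖ ≤ 1)
    (hs : ∀ a x y, A a x y ≠ 0 → |s x - s y| ≤ κ) {p : (V → Fin 2) → ℂ}
    (hp : gibbsSampler β (classicalHamiltonian E) A (Matrix.diagonal p) = 0)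
    {O : Op V} (hO : ‖O‖ ≤ 1) {t : ℝ} (ht : 0 ≤ t) :
    ‖(O * NormedSpace.exp ((t : ℂ) • gibbsSampler β (classicalHamiltonian E) A)
        (gibbsSampler β (classicalHamiltonian E) A
          (restrictedDiagonal p fun x => 2 * κ < s x))).trace‖
      ≤ J * rateBound β * ∑ x, if |s x| ≤ 2 * κ then ‖p x‖ else 0 := by
  set 𝓛 := gibbsSampler β (classicalHamiltonian E) A
  set Q : Op V := Matrix.diagonal (fun x => if 0 < s x then 1 else 0)
  have hQ : ‖Q‖ ≤ 1 := norm_diagonal_le_one fun x => by split_ifs <;> simp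
  set O' := heisenberg (NormedSpace.exp ((t : ℂ) • 𝓛)) O with hO'
  have hO'1 : ‖O'‖ ≤ 1 :=
    ((isDissipative_gibbsSampler hβ E hA).norm_exp_heisenberg_le ht O).trans hO
  rw [← trace_heisenberg_mul, ← hO', gibbsSampler_restrictedDiagonal E hβ hA hs hp, mul_neg,
    Matrix.trace_neg, norm_neg, ← mul_assoc, Matrix.trace_mul_comm, ← mul_assoc, ← mul_assoc]
  refine (norm_trace_gibbsSampler_diagonal_le E hβ hA _ _).trans ?_
  have hQOQ : ‖Q * O' * Q‖ ≤ 1 :=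
    (norm_mul_le _ _).trans (mul_le_one₀ ((norm_mul_le _ _).trans
      (mul_le_one₀ hQ (norm_nonneg _) hO'1)) (norm_nonneg _) hQ)
  have hr := rateBound_nonneg β
  have hsum : ∑ x, ‖if |s x| ≤ 2 * κ then p x else 0‖ = ∑ x, if |s x| ≤ 2 * κ then ‖p x‖ else 0 :=
    Finset.sum_congr rfl fun x _ => by split_ifs <;> simp
  rw [hsum]
  refine mul_le_mul_of_nonneg_right ?_ (Finset.sum_nonneg fun x _ => by split_ifs <;> positivity)
  exact mul_le_of_le_one_right (by positivity) hQOQ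

theorem hasDerivAt_trace_exp (𝓛 : SuperOp V) (O X : Op V) (t : ℝ) :
    HasDerivAt (fun τ : ℝ => (O * NormedSpace.exp ((τ : ℂ) • 𝓛) X).trace)
      (O * NormedSpace.exp ((t : ℂ) • 𝓛) (𝓛 X)).trace t := by
  have h := (hasDerivAt_exp_smul_const (𝕂 := ℂ) 𝓛 (t : ℂ)).scomp t
    (Complex.ofRealCLM.hasDerivAt (x := t))
  rw [Complex.ofRealCLM_apply, Complex.ofReal_one, one_smul] at h
  have h' := ((pairingCLM O X).restrictScalars ℝ).hasFDerivAt.comp_hasDerivAt t h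
  exact h'

/-- **Bottleneck bound.** Suppose that the jump operators change the statistic `s` by at most `κ`,
that the Gibbs weights are invariant under a permutation of the configurations that negates `s`, and
that the relative weight of the configurations with `|s| ≤ 2 * κ` is at most `δ`, where `δ` is at
most `1 / 2`. Then a time after which the trace distance of any two states has been halved is at
least of the order of `1 / δ`, up to the total rate of the jumps. -/
theorem one_le_of_halved (hβ : 0 < β) (hA : ∀ a, ‖A a‖ ≤ 1) (hadj : AdjointClosed A)
    (hs : ∀ a x y, A a x y ≠ 0 → |s x - s y| ≤ κ) (hκ : 0 ≤ κ)
    (φ : Equiv.Perm (V → Fin 2)) (hφE : ∀ x, E (φ x) = E x) (hφs : ∀ x, s (φ x) = -s x)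
    {δ : ℝ} (hδ : δ ≤ 1 / 2)
    (hD : ∑ x, (if |s x| ≤ 2 * κ then Real.exp (-β * E x) else 0)
      ≤ δ * ∑ x, Real.exp (-β * E x))
    {ε : ℝ} (hε : ε ≤ 1 / 2) {t : ℝ} (ht : 0 ≤ t)
    (hmix : ∀ ρ σ : Op V, IsState ρ → IsState σ →
      traceNorm (NormedSpace.exp ((t : ℂ) • gibbsSampler β (classicalHamiltonian E) A) (ρ - σ))
        ≤ ε * traceNorm (ρ - σ)) :
    1 ≤ 8 * (J * rateBound β) * δ * t := by
  set 𝓛 := gibbsSampler β (classicalHamiltonian E) A with h𝓛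
  set w : (V → Fin 2) → ℝ := fun x => Real.exp (-β * E x) with hw
  have hw0 : ∀ x, 0 < w x := fun x => Real.exp_pos _
  set Z := ∑ x, w x with hZ
  have hZ0 : 0 < Z := Finset.sum_pos (fun x _ => hw0 x) ⟨fun _ => 0, Finset.mem_univ _⟩
  -- the two wells carry the same weight `c`, which is at least `Z / 4`
  set c := ∑ x, if 2 * κ < s x then w x else 0 with hc
  have hc' : ∑ x, (if 2 * κ < -s x then w x else 0) = c := by
    rw [hc, ← Equiv.sum_comp φ]
    refine Finset.sum_congr rfl fun x _ => ?_
    simp only [hφs, hw, hφE, neg_neg]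
  have hsplit : Z = c + (∑ x, if |s x| ≤ 2 * κ then w x else 0) + c := by
    have h : Z = c + (∑ x, if |s x| ≤ 2 * κ then w x else 0)
        + ∑ x, (if 2 * κ < -s x then w x else 0) := by
      rw [hc, hZ, ← Finset.sum_add_distrib, ← Finset.sum_add_distrib]
      refine Finset.sum_congr rfl fun x _ => ?_
      simp only [abs_le]
      split_ifs <;> first | omega | simp
    rwa [hc'] at h
  have hcZ : Z / 4 ≤ c := by nlinarith
  have hc0 : 0 < c := by linarith
  set p : (V → Fin 2) → ℂ := fun x => ((w x / c : ℝ) : ℂ) with hp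
  have hp𝓛 : 𝓛 (Matrix.diagonal p) = 0 := by
    have h := gibbsSampler_gibbsState E hβ hA hadj
    rw [gibbsState_classicalHamiltonian] at h
    have hp' : (Matrix.diagonal p : Op V) = ((Z / c : ℝ) : ℂ) •
        Matrix.diagonal fun x => ((Real.exp (-β * E x) / ∑ y, Real.exp (-β * E y) : ℝ) : ℂ) := by
      rw [← Matrix.diagonal_smul]
      congr 1
      ext x
      simp only [hp, Pi.smul_apply, smul_eq_mul]
      rw [← Complex.ofReal_mul]
      congr 1
      change w x / c = Z / c * (w x / Z)
      field_simp
    rw [hp', map_smul, h, smul_zero]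
  have hstate : ∀ (P : (V → Fin 2) → Prop) [DecidablePred P], ∑ x, (if P x then w x else 0) = c →
      IsState (restrictedDiagonal p P) := by
    intro P _ hP
    refine ⟨Matrix.PosSemidef.diagonal fun x => ?_, ?_⟩
    · simp only [Pi.zero_apply, hp]
      split_ifs
      · exact_mod_cast (div_pos (hw0 x) hc0).le
      · exact le_rfl
    · rw [restrictedDiagonal, Matrix.trace_diagonal]
      have : ∀ x, (if P x then p x else 0) = (((if P x then w x else 0) / c : ℝ) : ℂ) := by
        intro x
        split_ifs <;> simp [hp]
      simp_rw [this]
      rw [← Complex.ofReal_sum, ← Finset.sum_div, hP, div_self hc0.ne', Complex.ofReal_one]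
  set ρ := restrictedDiagonal p fun x => 2 * κ < s x with hρ
  set σ := restrictedDiagonal p fun x => 2 * κ < -s x with hσ
  have hρs : IsState ρ := hstate _ rfl
  have hσs : IsState σ := hstate _ hc'
  -- the observable that tells the two wells apart
  set o : (V → Fin 2) → ℂ := fun x => if 0 < s x then 1 else -1 with ho
  set O : Op V := Matrix.diagonal o with hO
  have hO1 : ‖O‖ ≤ 1 := norm_diagonal_le_one fun x => by simp only [ho]; split_ifs <;> simp
  have hOρ : O * ρ = ρ := by
    rw [hO, hρ, restrictedDiagonal, Matrix.diagonal_mul_diagonal]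
    congr 1
    ext x
    simp only [ho]
    split_ifs <;> first | omega | simp
  have hOσ : O * σ = -σ := by
    rw [hO, hσ, restrictedDiagonal, Matrix.diagonal_mul_diagonal, eq_neg_iff_add_eq_zero,
      Matrix.diagonal_add, ← Matrix.diagonal_zero]
    congr 1
    ext x
    simp only [ho]
    split_ifs <;> first | omega | simp
  have hnorm : traceNorm (ρ - σ) ≤ 2 := by
    have h1 : ρ - σ = Matrix.diagonal fun x =>
        (if 2 * κ < s x then p x else 0) - (if 2 * κ < -s x then p x else 0) := by
      rw [hρ, hσ, restrictedDiagonal, restrictedDiagonal, Matrix.diagonal_sub]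
    have h2 : ∀ (P : (V → Fin 2) → Prop) [DecidablePred P], ∑ x, (if P x then w x else 0) = c →
        ∑ x, ‖if P x then p x else 0‖ = 1 := by
      intro P _ hP
      have : ∀ x, ‖if P x then p x else 0‖ = (if P x then w x else 0) / c := by
        intro x
        split_ifs
        · rw [hp, Complex.norm_real, Real.norm_of_nonneg (div_pos (hw0 x) hc0).le]
        · simp
      simp_rw [this]
      rw [← Finset.sum_div, hP, div_self hc0.ne']
    rw [h1, traceNorm_diagonal]
    refine (Finset.sum_le_sum fun x _ => norm_sub_le _ _).trans_eq ?_
    rw [Finset.sum_add_distrib, h2 _ rfl, h2 _ hc']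
    norm_num
  -- `f` drops from `2` to at most `1` in absolute value, at a speed bounded by the flow
  set f : ℝ → ℂ := fun τ => (O * NormedSpace.exp ((τ : ℂ) • 𝓛) (ρ - σ)).trace with hf
  have hf0 : f 0 = 2 := by
    simp only [hf]
    rw [Complex.ofReal_zero, zero_smul, NormedSpace.exp_zero, SuperOp.one_apply, mul_sub, hOρ, hOσ,
      sub_neg_eq_add, Matrix.trace_add, hρs.2, hσs.2]
    norm_num
  have hft : ‖f t‖ ≤ 1 := by
    refine (norm_trace_mul_le_mul_traceNorm _ _).trans ?_
    have h1 := hmix ρ σ hρs hσs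
    have h0 : ∀ Y : Op V, 0 ≤ traceNorm Y := fun Y => Finset.sum_nonneg fun _ _ => Real.sqrt_nonneg _
    calc _ ≤ 1 * (ε * traceNorm (ρ - σ)) := mul_le_mul hO1 h1 (h0 _) zero_le_one
      _ ≤ 1 * (1 / 2 * 2) := by
        refine mul_le_mul_of_nonneg_left ?_ zero_le_one
        exact mul_le_mul hε hnorm (h0 _) (by norm_num)
      _ = 1 := by norm_num
  have hr : 0 ≤ (J : ℝ) * rateBound β := mul_nonneg J.cast_nonneg (rateBound_nonneg β)
  have hflux : ∑ x, (if |s x| ≤ 2 * κ then ‖p x‖ else 0) ≤ 4 * δ := by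
    have h1 : ∀ x, (if |s x| ≤ 2 * κ then ‖p x‖ else 0)
        = (if |s x| ≤ 2 * κ then w x else 0) / c := by
      intro x
      split_ifs
      · rw [hp, Complex.norm_real, Real.norm_of_nonneg (div_pos (hw0 x) hc0).le]
      · simp
    simp_rw [h1]
    have hδ0 : 0 ≤ δ := by
      have h2 : (0 : ℝ) ≤ ∑ x, (if |s x| ≤ 2 * κ then w x else 0) :=
        Finset.sum_nonneg fun x _ => by split_ifs; exacts [(hw0 x).le, le_rfl]
      exact nonneg_of_mul_nonneg_left (h2.trans hD) hZ0
    rw [← Finset.sum_div, div_le_iff₀ hc0]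
    refine hD.trans ?_
    nlinarith
  have hbound : ∀ τ ∈ Set.Ico 0 t, ‖(O * NormedSpace.exp ((τ : ℂ) • 𝓛) (𝓛 (ρ - σ))).trace‖
      ≤ 8 * (J * rateBound β) * δ := by
    intro τ hτ
    have h1 := norm_trace_exp_gibbsSampler_restrictedDiagonal_le E hβ hA hs hp𝓛 hO1 hτ.1
    have h2 := norm_trace_exp_gibbsSampler_restrictedDiagonal_le E (s := fun x => -s x) hβ hA
      (fun a x y hxy => by rw [neg_sub_neg, abs_sub_comm]; exact hs a x y hxy) hp𝓛 hO1 hτ.1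
    simp only [abs_neg] at h2
    rw [map_sub, map_sub, mul_sub, Matrix.trace_sub]
    refine (norm_sub_le _ _).trans ((add_le_add h1 h2).trans ?_)
    have := mul_le_mul_of_nonneg_left hflux hr
    linarith
  have hdiff := norm_image_sub_le_of_norm_deriv_le_segment' (f := f)
    (fun τ _ => (hasDerivAt_trace_exp 𝓛 O (ρ - σ) τ).hasDerivWithinAt) hbound t
    ⟨ht, le_rfl⟩
  rw [hf0, sub_zero] at hdiff
  have h2 : ‖(2 : ℂ)‖ - ‖f t‖ ≤ ‖f t - 2‖ := by
    rw [norm_sub_rev]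
    exact norm_sub_norm_le _ _
  have h3 : ‖(2 : ℂ)‖ = 2 := by norm_num
  linarith

end Bottleneck

/-! ### Counting clusters -/

section Cluster

variable {α : Type} [Fintype α] [DecidableEq α] (nb : α → Finset α) (R : Finset α)

open Classical in
/-- The part of `S` that is connected to `R` inside `S`, where `nb` is the neighborhood relation:
the intersection of all subsets of `S` that contain `S ∩ R` and are closed under passing to
neighbors in `S`. -/
def cluster (S : Finset α) : Finset α :=
  S.filter fun e => ∀ T ⊆ S, S ∩ R ⊆ T → (∀ a ∈ T, ∀ b ∈ S, b ∈ nb a → b ∈ T) → e ∈ T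

variable {nb R}

theorem mem_cluster {S : Finset α} {e : α} : e ∈ cluster nb R S ↔ e ∈ S ∧
    ∀ T ⊆ S, S ∩ R ⊆ T → (∀ a ∈ T, ∀ b ∈ S, b ∈ nb a → b ∈ T) → e ∈ T := by
  rw [cluster, Finset.mem_filter]

theorem cluster_subset (S : Finset α) : cluster nb R S ⊆ S := Finset.filter_subset _ _

theorem inter_subset_cluster (S : Finset α) : S ∩ R ⊆ cluster nb R S := fun _ he =>
  mem_cluster.2 ⟨(Finset.mem_inter.1 he).1, fun _ _ hT _ => hT he⟩

theorem mem_cluster_of_mem_nb {S : Finset α} {a b : α} (ha : a ∈ cluster nb R S) (hb : b ∈ S)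
    (hab : b ∈ nb a) : b ∈ cluster nb R S :=
  mem_cluster.2 ⟨hb, fun T hTS hRT hT => hT a ((mem_cluster.1 ha).2 T hTS hRT hT) b hb hab⟩

theorem cluster_subset_of_closed {S T : Finset α} (hTS : T ⊆ S) (hRT : S ∩ R ⊆ T)
    (hT : ∀ a ∈ T, ∀ b ∈ S, b ∈ nb a → b ∈ T) : cluster nb R S ⊆ T :=
  fun _ he => (mem_cluster.1 he).2 T hTS hRT hT

/-- The cluster of `S` does not depend on what `S` is away from the cluster, its neighbors and the
seeds `R`. -/
theorem cluster_union_eq (S T : Finset α)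
    (hT : Disjoint T ((cluster nb R S).biUnion nb ∪ R)) :
    cluster nb R (cluster nb R S ∪ T) = cluster nb R S := by
  set G := cluster nb R S with hG
  rw [Finset.disjoint_union_right] at hT
  refine (cluster_subset_of_closed Finset.subset_union_left ?_ ?_).antisymm ?_
  · intro e he
    obtain ⟨he1, he2⟩ := Finset.mem_inter.1 he
    exact (Finset.mem_union.1 he1).resolve_right fun h => Finset.disjoint_left.1 hT.2 h he2
  · intro a ha b hb hab
    exact (Finset.mem_union.1 hb).resolve_right fun h =>
      Finset.disjoint_left.1 hT.1 h (Finset.mem_biUnion.2 ⟨a, ha, hab⟩)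
  · intro e he
    refine mem_cluster.2 ⟨Finset.mem_union_left _ he, fun T' _ hRT' hT' => ?_⟩
    have h : G ⊆ T' ∩ G := by
      refine cluster_subset_of_closed (Finset.inter_subset_right.trans (cluster_subset S)) ?_ ?_
      · intro f hf
        have hfG : f ∈ G := inter_subset_cluster S hf
        exact Finset.mem_inter.2 ⟨hRT' (Finset.mem_inter.2
          ⟨Finset.mem_union_left _ hfG, (Finset.mem_inter.1 hf).2⟩), hfG⟩
      · intro a ha b hb hab
        obtain ⟨ha1, ha2⟩ := Finset.mem_inter.1 ha
        have hbG : b ∈ G := mem_cluster_of_mem_nb ha2 hb hab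
        exact Finset.mem_inter.2 ⟨hT' a ha1 b (Finset.mem_union_left _ hbG) hab, hbG⟩
    exact (Finset.mem_inter.1 (h he)).1

variable (nb R) in
/-- The sets that occur as clusters. -/
def clusters : Finset (Finset α) := Finset.univ.image (cluster nb R)

/-- The generating function of clusters is bounded. In a uniformly random subset of `α`, the events
that the cluster is `G` are disjoint for different `G`, and each has probability at least
`2 ^ (-(Δ * #G + #R))`, as it is determined by the at most `Δ * #G + #R` elements that are in `R` or
neighbors of `G`. -/
theorem sum_clusters_le_one {Δ : ℕ} (hself : ∀ a, a ∈ nb a) (hΔ : ∀ a, (nb a).card ≤ Δ) :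
    ∑ G ∈ clusters nb R, (1 / 2 : ℝ) ^ (Δ * G.card + R.card) ≤ 1 := by
  have hfiber : ∀ G ∈ clusters nb R, (2 : ℝ) ^ Fintype.card α * (1 / 2) ^ (Δ * G.card + R.card)
      ≤ ((Finset.univ.filter fun S => cluster nb R S = G).card : ℝ) := by
    intro G hG
    obtain ⟨S, -, rfl⟩ := Finset.mem_image.1 hG
    set G := cluster nb R S with hGdef
    set K := G.biUnion nb ∪ R with hK
    have hGK : G ⊆ K := fun a ha =>
      Finset.mem_union_left _ (Finset.mem_biUnion.2 ⟨a, ha, hself a⟩)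
    have hKcard : K.card ≤ Δ * G.card + R.card := by
      refine (Finset.card_union_le _ _).trans (Nat.add_le_add_right ?_ _)
      refine Finset.card_biUnion_le.trans ((Finset.sum_le_card_nsmul _ _ _ fun a _ => hΔ a).trans ?_)
      rw [smul_eq_mul, mul_comm]
    have hinj : (Kᶜ.powerset).card ≤ (Finset.univ.filter fun S => cluster nb R S = G).card := by
      refine Finset.card_le_card_of_injOn (fun T => G ∪ T) ?_ ?_
      · intro T hT
        have hd : Disjoint T K := by
          rw [← Finset.subset_compl_iff_disjoint_right]
          exact Finset.mem_powerset.1 hT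
        simpa using cluster_union_eq S T hd
      · intro T hT T' hT' h
        have hd : ∀ T ∈ Kᶜ.powerset, Disjoint G T := fun T hT =>
          Finset.disjoint_of_subset_left hGK (Finset.disjoint_of_subset_right
            (Finset.mem_powerset.1 hT) disjoint_compl_right)
        have h' : (G ∪ T) \ G = (G ∪ T') \ G := congrArg (· \ G) h
        rwa [Finset.union_sdiff_cancel_left (hd T hT),
          Finset.union_sdiff_cancel_left (hd T' hT')] at h'
    rw [Finset.card_powerset, Finset.card_compl] at hinj
    refine le_trans ?_ (Nat.cast_le.2 hinj)
    push_cast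
    have hle : K.card ≤ Fintype.card α := Finset.card_le_univ K
    calc (2 : ℝ) ^ Fintype.card α * (1 / 2) ^ (Δ * G.card + R.card)
        ≤ 2 ^ Fintype.card α * (1 / 2) ^ K.card :=
          mul_le_mul_of_nonneg_left (pow_le_pow_of_le_one (by norm_num) (by norm_num) hKcard)
            (by positivity)
      _ = 2 ^ (Fintype.card α - K.card) := by
          rw [pow_sub₀ _ two_ne_zero hle, one_div, inv_pow]
  have hsum := Finset.sum_le_sum hfiber
  rw [← Finset.mul_sum, ← Nat.cast_sum] at hsum
  have hcard : ∑ G ∈ clusters nb R, (Finset.univ.filter fun S => cluster nb R S = G).card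
      = 2 ^ Fintype.card α := by
    rw [← Finset.card_eq_sum_card_fiberwise (f := cluster nb R) (s := Finset.univ)
      (t := clusters nb R) (fun S _ => Finset.mem_image_of_mem _ (Finset.mem_univ S)),
      Finset.card_univ, Fintype.card_finset]
  rw [hcard] at hsum
  push_cast at hsum
  exact le_of_mul_le_mul_left (by rwa [mul_one]) (by positivity : (0 : ℝ) < 2 ^ Fintype.card α)

end Cluster

/-! ### The contours of the Ising model -/

section Ising

variable {N : ℕ}

/-- `q` is the neighbor of `p` below (for `d = true`) or to the right (for `d = false`). The pair
`(p, d)` is used to denote this bond. -/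
def Step (d : Bool) (p q : Site N) : Prop :=
  match d with
  | false => p.1 = q.1 ∧ p.2.val + 1 = q.2.val
  | true => p.2 = q.2 ∧ p.1.val + 1 = q.1.val

theorem isBond_iff {p q : Site N} : IsBond p q ↔ Step false p q ∨ Step true p q := Iff.rfl

theorem Step.unique {d : Bool} {p q q' : Site N} (h : Step d p q) (h' : Step d p q') : q = q' := by
  cases d <;> simp only [Step] at h h' <;> refine Prod.ext (Fin.ext ?_) (Fin.ext ?_) <;> omega

instance (d : Bool) (p q : Site N) : Decidable (Step d p q) := by
  cases d <;> exact inferInstanceAs (Decidable (_ ∧ _))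

/-- The bonds that are not satisfied by the configuration `x`; these are dual to its contours. -/
def unsat (x : Site N → Fin 2) : Finset (Site N × Bool) :=
  Finset.univ.filter fun e => ∃ q, Step e.2 e.1 q ∧ x e.1 ≠ x q

theorem mem_unsat {x : Site N → Fin 2} {e : Site N × Bool} :
    e ∈ unsat x ↔ ∃ q, Step e.2 e.1 q ∧ x e.1 ≠ x q := by
  rw [unsat, Finset.mem_filter]
  simp

theorem mk_mem_unsat {x : Site N → Fin 2} {d : Bool} {p q : Site N} (h : Step d p q) :
    (p, d) ∈ unsat x ↔ x p ≠ x q := by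
  rw [mem_unsat]
  exact ⟨fun ⟨q', h1, h2⟩ => h.unique h1 ▸ h2, fun h2 => ⟨q, h, h2⟩⟩

/-- The energy of a configuration, in terms of its unsatisfied bonds. -/
def isingEnergy (N : ℕ) (x : Site N → Fin 2) : ℝ :=
  2 * (unsat x).card - (Finset.univ.filter fun e : Site N × Site N => IsBond e.1 e.2).card

theorem card_unsat (x : Site N → Fin 2) :
    (Finset.univ.filter fun e : Site N × Site N => IsBond e.1 e.2 ∧ x e.1 ≠ x e.2).card
      = (unsat x).card := by
  refine Finset.card_bij (fun e _ => (e.1, decide (e.1.2 = e.2.2))) ?_ ?_ ?_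
  · rintro ⟨p, q⟩ h
    simp only [Finset.mem_filter, Finset.mem_univ, true_and, isBond_iff] at h
    rcases h.1 with h1 | h1
    · have : ¬ p.2 = q.2 := fun h2 => by have := h1.2; rw [h2] at this; omega
      simpa [this] using (mk_mem_unsat h1).2 h.2
    · simpa [h1.1] using (mk_mem_unsat h1).2 h.2
  · rintro ⟨p, q⟩ h ⟨p', q'⟩ h' heq
    simp only [Finset.mem_filter, Finset.mem_univ, true_and, isBond_iff, Step] at h h'
    simp only [Prod.mk.injEq, decide_eq_decide] at heq
    obtain ⟨rfl, h2⟩ := heq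
    refine Prod.ext rfl (Prod.ext (Fin.ext ?_) (Fin.ext ?_)) <;> simp only [Fin.ext_iff] at * <;>
      omega
  · rintro ⟨p, d⟩ h
    obtain ⟨q, h1, h2⟩ := mem_unsat.1 h
    refine ⟨(p, q), ?_, ?_⟩
    · simp only [Finset.mem_filter, Finset.mem_univ, true_and, isBond_iff]
      refine ⟨?_, h2⟩
      cases d
      exacts [Or.inl h1, Or.inr h1]
    · cases d
      · have : ¬ p.2 = q.2 := fun h2 => by
          have := h1.2
          simp only [h2] at this
          omega
        simp [this]
      · simpa using h1.1

theorem ising2D_eq (N : ℕ) : ising2D N = classicalHamiltonian (isingEnergy N) := by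
  have hdiag : ising2D N = Matrix.diagonal fun x : Site N → Fin 2 =>
      -∑ p, ∑ q, if IsBond p q then
        (if x p = 0 then (1 : ℂ) else -1) * (if x q = 0 then 1 else -1) else 0 := by
    ext x y
    rw [ising2D, Matrix.neg_apply, Matrix.sum_apply, Matrix.diagonal_apply]
    simp_rw [Matrix.sum_apply]
    by_cases hxy : x = y
    · subst hxy
      rw [if_pos rfl]
      congr 1
      refine Finset.sum_congr rfl fun p _ => Finset.sum_congr rfl fun q _ => ?_
      split_ifs <;> simp_all [pauliZ]
    · rw [if_neg hxy, neg_eq_zero]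
      refine Finset.sum_eq_zero fun p _ => Finset.sum_eq_zero fun q _ => ?_
      split_ifs
      · simp [pauliZ, hxy]
      · simp
  rw [hdiag, classicalHamiltonian]
  congr 1
  ext x
  have hterm : ∀ p q : Site N, (if IsBond p q then
      (if x p = 0 then (1 : ℂ) else -1) * (if x q = 0 then 1 else -1) else 0)
      = (if IsBond p q then 1 else 0) - 2 * (if IsBond p q ∧ x p ≠ x q then 1 else 0) := by
    intro p q
    have h01 : ∀ a b : Fin 2, (if a = 0 then (1 : ℂ) else -1) * (if b = 0 then 1 else -1)
        = 1 - 2 * (if a ≠ b then 1 else 0) := by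
      intro a b
      fin_cases a <;> fin_cases b <;> norm_num
    rw [h01]
    by_cases h : IsBond p q <;> simp [h]
  simp_rw [hterm, Finset.sum_sub_distrib, ← Finset.mul_sum, ← Fintype.sum_prod_type',
    Finset.sum_boole]
  rw [card_unsat, isingEnergy]
  push_cast
  ring

/-- A function on the bonds that sums to zero around every plaquette is the gradient of a
configuration, obtained by summing along the first column and then along a row. -/
theorem exists_potential (f : Site N × Bool → Fin 2)
    (hf : ∀ a b c d : Site N, Step false a b → Step true a c → Step false c d → Step true b d →
      f (a, true) + f (c, false) = f (a, false) + f (b, true)) :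
    ∃ w : Site N → Fin 2, ∀ d p q, Step d p q → w q = w p + f (p, d) := by
  set F : ℕ → ℕ → Bool → Fin 2 := fun i j d =>
    if h : i < N ∧ j < N then f ((⟨i, h.1⟩, ⟨j, h.2⟩), d) else 0 with hF
  have hFf : ∀ (p : Site N) d, F p.1 p.2 d = f (p, d) := fun p d => by
    simp only [hF]
    rw [dif_pos ⟨p.1.2, p.2.2⟩]
  set W : ℕ → ℕ → Fin 2 := fun i j =>
    ∑ r ∈ Finset.range i, F r 0 true + ∑ c ∈ Finset.range j, F i c false with hW
  have hhor : ∀ i j, W i (j + 1) = W i j + F i j false := fun i j => by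
    simp only [hW]
    rw [Finset.sum_range_succ, add_assoc]
  have hver : ∀ i, i + 1 < N → ∀ j, j < N → W (i + 1) j = W i j + F i j true := by
    intro i hi j
    induction j with
    | zero =>
      intro _
      simp only [hW, Finset.range_zero, Finset.sum_empty, add_zero]
      rw [Finset.sum_range_succ]
    | succ j ih =>
      intro hj
      have h := hf (⟨i, by omega⟩, ⟨j, by omega⟩) (⟨i, by omega⟩, ⟨j + 1, hj⟩)
        (⟨i + 1, hi⟩, ⟨j, by omega⟩) (⟨i + 1, hi⟩, ⟨j + 1, hj⟩) ⟨rfl, rfl⟩ ⟨rfl, rfl⟩ ⟨rfl, rfl⟩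
        ⟨rfl, rfl⟩
      rw [← hFf, ← hFf, ← hFf, ← hFf] at h
      rw [hhor, hhor, ih (by omega)]
      exact (add_assoc _ _ _).trans ((congrArg (W i j + ·) h).trans (add_assoc _ _ _).symm)
  refine ⟨fun p => W p.1 p.2, fun d p q h => ?_⟩
  cases d
  · change W q.1 q.2 = _
    rw [← h.2, ← h.1, hhor, hFf]
  · change W q.1 q.2 = _
    have hq := q.1.2
    rw [← h.2] at hq
    rw [← h.2, ← h.1, hver _ hq _ p.2.2, hFf]

/-- Bonds are neighbors if their base points differ by at most one in both coordinates; in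
particular, the bonds of a plaquette are neighbors of each other. -/
def nearBonds (e : Site N × Bool) : Finset (Site N × Bool) :=
  Finset.univ.filter fun f => (f.1.1.val ≤ e.1.1.val + 1 ∧ e.1.1.val ≤ f.1.1.val + 1) ∧
    (f.1.2.val ≤ e.1.2.val + 1 ∧ e.1.2.val ≤ f.1.2.val + 1)

theorem mem_nearBonds {e f : Site N × Bool} : f ∈ nearBonds e ↔
    (f.1.1.val ≤ e.1.1.val + 1 ∧ e.1.1.val ≤ f.1.1.val + 1) ∧
      (f.1.2.val ≤ e.1.2.val + 1 ∧ e.1.2.val ≤ f.1.2.val + 1) := by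
  simp [nearBonds]

theorem self_mem_nearBonds (e : Site N × Bool) : e ∈ nearBonds e :=
  mem_nearBonds.2 (by omega)

theorem card_nearBonds_le (e : Site N × Bool) : (nearBonds e).card ≤ 18 := by
  have h : (nearBonds e).card ≤ ((Finset.Icc e.1.1.val (e.1.1.val + 2) ×ˢ
      Finset.Icc e.1.2.val (e.1.2.val + 2)) ×ˢ (Finset.univ : Finset Bool)).card := by
    refine Finset.card_le_card_of_injOn (fun f => ((f.1.1.val + 1, f.1.2.val + 1), f.2)) ?_ ?_
    · intro f hf
      have := mem_nearBonds.1 hf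
      simp only [Finset.coe_product, Set.mem_prod, Finset.mem_coe, Finset.mem_Icc, Finset.mem_univ,
        and_true]
      omega
    · rintro ⟨⟨a, b⟩, d⟩ _ ⟨⟨a', b'⟩, d'⟩ _ h
      simp only [Prod.mk.injEq, add_left_inj] at h
      obtain ⟨⟨h1, h2⟩, rfl⟩ := h
      rw [Fin.ext h1, Fin.ext h2]
  refine h.trans_eq ?_
  rw [Finset.card_product, Finset.card_product, Nat.card_Icc, Nat.card_Icc]
  rw [Finset.card_univ, Fintype.card_bool, add_assoc, add_assoc, Nat.add_sub_cancel_left,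
    Nat.add_sub_cancel_left]
  norm_num

/-- The bonds of the first row. -/
def rowBonds (N : ℕ) : Finset (Site N × Bool) :=
  Finset.univ.filter fun e => e.1.1.val = 0 ∧ e.2 = false

theorem card_rowBonds_le : (rowBonds N).card ≤ N := by
  have h : (rowBonds N).card ≤ (Finset.univ : Finset (Fin N)).card := by
    refine Finset.card_le_card_of_injOn (fun e => e.1.2) (fun _ _ => Finset.mem_univ _) ?_
    rintro ⟨⟨a, b⟩, d⟩ h1 ⟨⟨a', b'⟩, d'⟩ h2 h
    simp only [rowBonds, Finset.coe_filter, Finset.mem_univ, true_and, Set.mem_ofPred_eq] at h1 h2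
    obtain ⟨h1, rfl⟩ := h1
    obtain ⟨h2, rfl⟩ := h2
    simp only at h
    rw [h, Fin.ext (h1.trans h2.symm)]
  simpa using h

/-- The contours of `x` that meet the first row. -/
def rowContours (x : Site N → Fin 2) : Finset (Site N × Bool) :=
  cluster nearBonds (rowBonds N) (unsat x)

/-- The contours that meet the first row can be removed: they are the contours of a configuration
`w`, and adding `w` to a configuration that has these contours erases them. -/
theorem exists_unsat_eq_rowContours (x : Site N → Fin 2) :
    ∃ w : Site N → Fin 2, unsat w = rowContours x ∧
      ∀ y, rowContours x ⊆ unsat y → unsat (y + w) = unsat y \ rowContours x := by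
  set G := rowContours x with hG
  have hGx : G ⊆ unsat x := cluster_subset _
  have hclosed : ∀ e ∈ G, ∀ f ∈ unsat x, f ∈ nearBonds e → f ∈ G :=
    fun e he f hf hef => mem_cluster_of_mem_nb he hf hef
  obtain ⟨w, hw⟩ := exists_potential (fun e => if e ∈ G then 1 else 0) (by
    intro a b c d hab hac hcd hbd
    have h1 := mk_mem_unsat (x := x) hab
    have h2 := mk_mem_unsat (x := x) hac
    have h3 := mk_mem_unsat (x := x) hcd
    have h4 := mk_mem_unsat (x := x) hbd
    simp only [Step] at hab hac hcd hbd
    simp only [Fin.ext_iff] at hab hac hcd hbd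
    by_cases hne : ∃ e ∈ G, e = (a, true) ∨ e = (c, false) ∨ e = (a, false) ∨ e = (b, true)
    · -- all unsatisfied bonds of the plaquette belong to `G`
      obtain ⟨e, he, hcase⟩ := hne
      have hiff : ∀ f : Site N × Bool, f = (a, true) ∨ f = (c, false) ∨ f = (a, false) ∨
          f = (b, true) → (f ∈ G ↔ f ∈ unsat x) := by
        intro f hf
        refine ⟨fun h => hGx h, fun h => hclosed e he f h (mem_nearBonds.2 ?_)⟩
        rcases hcase with rfl | rfl | rfl | rfl <;> rcases hf with rfl | rfl | rfl | rfl <;>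
          simp only <;> omega
      simp only [hiff (a, true) (by simp), hiff (c, false) (by simp), hiff (a, false) (by simp),
        hiff (b, true) (by simp), h1, h2, h3, h4]
      generalize x a = xa
      generalize x b = xb
      generalize x c = xc
      generalize x d = xd
      revert xa xb xc xd
      decide
    · have hnot : ∀ f : Site N × Bool, f = (a, true) ∨ f = (c, false) ∨ f = (a, false) ∨
          f = (b, true) → f ∉ G := fun f hf hfG => hne ⟨f, hfG, hf⟩
      simp only [hnot (a, true) (by simp), hnot (c, false) (by simp), hnot (a, false) (by simp),
        hnot (b, true) (by simp)])
  have hdec₁ : ∀ a : Fin 2, ∀ P : Prop, [Decidable P] → ((a ≠ a + if P then 1 else 0) ↔ P) := by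
    intro a P _
    split_ifs with hP
    · simp only [hP, iff_true]
      revert a
      decide
    · simp [hP]
  have hdec₂ : ∀ a b c : Fin 2, (a + c ≠ b + (c + 1)) ↔ ¬ a ≠ b := by decide
  have hdec₃ : ∀ a b c : Fin 2, (a + c ≠ b + (c + 0)) ↔ a ≠ b := by decide
  refine ⟨w, ?_, fun y hy => ?_⟩
  · ext ⟨p, d⟩
    by_cases hq : ∃ q, Step d p q
    · obtain ⟨q, hq⟩ := hq
      rw [mk_mem_unsat hq, hw d p q hq]
      exact hdec₁ _ _
    · refine ⟨fun h => ?_, fun h => ?_⟩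
      · obtain ⟨q, h1, _⟩ := mem_unsat.1 h
        exact absurd ⟨q, h1⟩ hq
      · obtain ⟨q, h1, _⟩ := mem_unsat.1 (hGx h)
        exact absurd ⟨q, h1⟩ hq
  · ext ⟨p, d⟩
    rw [Finset.mem_sdiff]
    by_cases hq : ∃ q, Step d p q
    · obtain ⟨q, hq⟩ := hq
      have hyG : (p, d) ∈ G → y p ≠ y q := fun h => (mk_mem_unsat hq).1 (hy h)
      rw [mk_mem_unsat hq, mk_mem_unsat hq, Pi.add_apply, Pi.add_apply, hw d p q hq]
      by_cases hpG : (p, d) ∈ G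
      · rw [if_pos hpG, hdec₂]
        simp [hpG, hyG hpG]
      · rw [if_neg hpG, hdec₃]
        simp [hpG]
    · refine ⟨fun h => ?_, fun h => ?_⟩
      · obtain ⟨q, h1, _⟩ := mem_unsat.1 h
        exact absurd ⟨q, h1⟩ hq
      · obtain ⟨q, h1, _⟩ := mem_unsat.1 h.1
        exact absurd ⟨q, h1⟩ hq

end Ising

/-! ### The magnetization of the first row at low temperature -/

section Row

variable {N : ℕ}

/-- The eigenvalue of the Pauli operator `Z` on a basis state. -/
def spin (a : Fin 2) : ℤ := if a = 0 then 1 else -1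

theorem spin_add (a b : Fin 2) : spin (a + b) = spin a * spin b := by
  revert a b
  decide

theorem abs_spin (a : Fin 2) : |spin a| = 1 := by
  revert a
  decide

/-- The magnetization of the first row. -/
def rowSum (x : Site N → Fin 2) : ℤ := ∑ p : Site N, if p.1.val = 0 then spin (x p) else 0

theorem rowSum_eq (hN : 0 < N) (x : Site N → Fin 2) : rowSum x = ∑ j, spin (x (⟨0, hN⟩, j)) := by
  rw [rowSum, Fintype.sum_prod_type, Finset.sum_eq_single (⟨0, hN⟩ : Fin N)]
  · simp
  · intro i _ hi
    have : i.val ≠ 0 := fun h => hi (Fin.ext h)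
    simp [this]
  · simp

theorem abs_rowSum_sub_le_of_isLocalOp {k : ℕ} {A : Op (Site N)} (hA : IsLocalOp k A)
    {x y : Site N → Fin 2} (hxy : A x y ≠ 0) : |rowSum x - rowSum y| ≤ 2 * k := by
  obtain ⟨S, hS, M, hM⟩ := hA
  have hoff : ∀ i, i ∉ S → x i = y i := by
    by_contra h
    exact hxy (by rw [hM, if_neg h])
  rw [rowSum, rowSum, ← Finset.sum_sub_distrib]
  have hterm : ∀ p : Site N, |(if p.1.val = 0 then spin (x p) else 0)
      - (if p.1.val = 0 then spin (y p) else 0)| ≤ if p ∈ S then 2 else 0 := by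
    intro p
    by_cases hp : p ∈ S
    · rw [if_pos hp]
      split_ifs
      · exact (abs_sub _ _).trans (by rw [abs_spin, abs_spin]; norm_num)
      · simp
    · rw [if_neg hp, hoff p hp, sub_self, abs_zero]
  refine (Finset.abs_sum_le_sum_abs _ _).trans ((Finset.sum_le_sum fun p _ => hterm p).trans ?_)
  rw [Finset.sum_ite_mem, Finset.univ_inter, Finset.sum_const, nsmul_eq_mul, mul_comm]
  have : (S.card : ℤ) ≤ k := by exact_mod_cast hS
  linarith

theorem eq_of_forall_succ_eq {y : Fin N → Fin 2}
    (hy : ∀ j j' : Fin N, j.val + 1 = j'.val → y j = y j') (j j' : Fin N) : y j = y j' := by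
  have hzero : ∀ (n : ℕ) (hn : n < N) (h0 : 0 < N), y ⟨n, hn⟩ = y ⟨0, h0⟩ := by
    intro n
    induction n with
    | zero => exact fun _ _ => rfl
    | succ n ih => exact fun hn h0 => (hy ⟨n, by omega⟩ ⟨n + 1, hn⟩ rfl).symm.trans (ih _ h0)
  have h0 : 0 < N := lt_of_le_of_lt (Nat.zero_le _) j.2
  exact (hzero j j.2 h0).trans (hzero j' j'.2 h0).symm

/-- If adding `w` erases all unsatisfied bonds of the first row of `x`, then the first row of `x + w`
is constant, so the first rows of `x` and `w` agree up to a flip. -/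
theorem abs_rowSum_eq_of_unsat_add {x w : Site N → Fin 2}
    (h : ∀ e ∈ rowBonds N, e ∉ unsat (x + w)) : |rowSum w| = |rowSum x| := by
  rcases Nat.eq_zero_or_pos N with rfl | hN
  · simp [rowSum]
  have hconst := eq_of_forall_succ_eq (y := fun j => (x + w) (⟨0, hN⟩, j)) (by
    intro j j' hjj
    by_contra hne
    have hstep : Step false ((⟨0, hN⟩, j) : Site N) (⟨0, hN⟩, j') := ⟨rfl, hjj⟩
    exact h ((⟨0, hN⟩, j), false) (by simp [rowBonds]) ((mk_mem_unsat hstep).2 hne))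
  obtain ⟨c, hc⟩ : ∃ c, ∀ j, (x + w) (⟨0, hN⟩, j) = c := ⟨_, fun j => hconst j ⟨0, hN⟩⟩
  have hw : rowSum w = spin c * rowSum x := by
    rw [rowSum_eq hN, rowSum_eq hN, Finset.mul_sum]
    refine Finset.sum_congr rfl fun j _ => ?_
    rw [← hc j, Pi.add_apply, spin_add, mul_right_comm, ← spin_add]
    have : x (⟨0, hN⟩, j) + x (⟨0, hN⟩, j) = 0 := by
      generalize x (⟨0, hN⟩, j) = a
      revert a
      decide
    rw [this]
    simp [spin]
  rw [hw, abs_mul, abs_spin, one_mul]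

/-- An isoperimetric inequality: a configuration whose first row is balanced has many unsatisfied
bonds. If two columns without unsatisfied bonds have different values, then every row has an
unsatisfied bond; otherwise the minority of the first row is contained in the columns that have an
unsatisfied bond. -/
theorem le_abs_rowSum_add_card_unsat (w : Site N → Fin 2) :
    (N : ℤ) ≤ |rowSum w| + 2 * (unsat w).card := by
  rcases Nat.eq_zero_or_pos N with rfl | hN
  · simp only [Nat.cast_zero]
    positivity
  set bad : Finset (Fin N) := (unsat w).image fun e => e.1.2 with hbad
  have hbadcard : bad.card ≤ (unsat w).card := Finset.card_image_le
  have hgood : ∀ j ∉ bad, ∀ i, w (i, j) = w (⟨0, hN⟩, j) := by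
    intro j hj i
    refine eq_of_forall_succ_eq (y := fun i => w (i, j)) (fun i i' hii => ?_) i ⟨0, hN⟩
    by_contra hne
    have hstep : Step true ((i, j) : Site N) (i', j) := ⟨rfl, hii⟩
    exact hj (Finset.mem_image.2 ⟨((i, j), true), (mk_mem_unsat hstep).2 hne, rfl⟩)
  by_cases hcase : ∃ j ∉ bad, ∃ j' ∉ bad, w (⟨0, hN⟩, j) ≠ w (⟨0, hN⟩, j')
  · obtain ⟨j, hj, j', hj', hne⟩ := hcase
    have hrow : (Finset.univ : Finset (Fin N)) ⊆ (unsat w).image fun e => e.1.1 := by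
      intro i _
      by_contra hi
      refine hne ?_
      rw [← hgood j hj i, ← hgood j' hj' i]
      refine eq_of_forall_succ_eq (y := fun j => w (i, j)) (fun a b hab => ?_) j j'
      by_contra hne'
      have hstep : Step false ((i, a) : Site N) (i, b) := ⟨rfl, hab⟩
      exact hi (Finset.mem_image.2 ⟨((i, a), false), (mk_mem_unsat hstep).2 hne', rfl⟩)
    have h := (Finset.card_le_card hrow).trans Finset.card_image_le
    rw [Finset.card_univ, Fintype.card_fin] at h
    have := abs_nonneg (rowSum w)
    omega
  · obtain ⟨v, hv⟩ : ∃ v : Fin 2, ∀ j ∉ bad, w (⟨0, hN⟩, j) = v := by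
      by_cases hex : ∃ j, j ∉ bad
      · obtain ⟨j, hj⟩ := hex
        refine ⟨w (⟨0, hN⟩, j), fun j' hj' => ?_⟩
        by_contra hne
        exact hcase ⟨j', hj', j, hj, hne⟩
      · exact ⟨0, fun j hj => absurd ⟨j, hj⟩ hex⟩
    have hterm : ∀ j, (1 : ℤ) - 2 * (if j ∈ bad then 1 else 0) ≤ spin v * spin (w (⟨0, hN⟩, j)) := by
      intro j
      by_cases hj : j ∈ bad
      · rw [if_pos hj, ← spin_add]
        have := abs_spin (v + w (⟨0, hN⟩, j))
        have := neg_abs_le (spin (v + w (⟨0, hN⟩, j)))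
        omega
      · rw [if_neg hj, hv j hj]
        exact (by decide : ∀ v : Fin 2, (1 : ℤ) - 2 * 0 ≤ spin v * spin v) v
    have hsum := Finset.sum_le_sum fun j (_ : j ∈ Finset.univ) => hterm j
    rw [← Finset.mul_sum, ← rowSum_eq hN, Finset.sum_sub_distrib, ← Finset.mul_sum] at hsum
    simp only [Finset.sum_const, Finset.card_univ, Fintype.card_fin, nsmul_eq_mul, mul_one,
      Finset.sum_ite_mem, Finset.univ_inter] at hsum
    have habs : spin v * rowSum w ≤ |rowSum w| := by
      refine (le_abs_self _).trans_eq ?_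
      rw [abs_mul, abs_spin, one_mul]
    have : (bad.card : ℤ) ≤ (unsat w).card := by exact_mod_cast hbadcard
    linarith

/-- For `β ≥ 9`, the Boltzmann weight `exp (-2 β g)` of `g` unsatisfied bonds pays for the entropy,
since `exp (-14) ≤ 2 ^ (-18)`, and leaves `exp (-4 g)`, of which `exp (-2 N + 2 m)` remains when
`N ≤ m + 2 g`. -/
theorem exp_neg_le_half_pow {β : ℝ} (hβ : 9 ≤ β) {g r : ℕ} {m : ℝ} (hr : r ≤ N)
    (hg : (N : ℝ) ≤ m + 2 * g) :
    Real.exp (-2 * β * g) ≤ (1 / 2) ^ (18 * g + r) * Real.exp (2 * m - N) := by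
  have h18 : Real.exp (-14) ≤ (1 / 2) ^ 18 := by
    have h1 : (2 : ℝ) ^ 18 ≤ Real.exp 14 := by
      have h2 : Real.exp 14 = Real.exp 1 ^ 14 := by rw [← Real.exp_nat_mul]; norm_num
      rw [h2]
      have h3 : (2.7 : ℝ) ≤ Real.exp 1 := by linarith [Real.exp_one_gt_d9]
      exact le_trans (by norm_num) (pow_le_pow_left₀ (by norm_num) h3 14)
    rw [Real.exp_neg, one_div, inv_pow]
    exact inv_anti₀ (by positivity) h1
  have h1 : Real.exp (-1) ≤ 1 / 2 := by
    rw [Real.exp_neg, one_div]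
    exact inv_anti₀ two_pos (by linarith [Real.exp_one_gt_d9])
  have hpow : Real.exp (-14 * g - r) ≤ (1 / 2) ^ (18 * g + r) := by
    rw [pow_add, pow_mul, sub_eq_add_neg, Real.exp_add]
    refine mul_le_mul ?_ ?_ (Real.exp_pos _).le (by positivity)
    · rw [mul_comm, Real.exp_nat_mul]
      exact pow_le_pow_left₀ (Real.exp_pos _).le h18 g
    · rw [show -(r : ℝ) = r * (-1) by ring, Real.exp_nat_mul]
      exact pow_le_pow_left₀ (Real.exp_pos _).le h1 r
  refine le_trans ?_ (mul_le_mul_of_nonneg_right hpow (Real.exp_pos _).le)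
  rw [← Real.exp_add, Real.exp_le_exp]
  have hr' : (r : ℝ) ≤ N := by exact_mod_cast hr
  nlinarith [mul_nonneg (sub_nonneg.2 hβ) (Nat.cast_nonneg (α := ℝ) g)]

/-- **Peierls argument.** At low temperature, a balanced first row is exponentially unlikely: it
forces the contours that meet this row to have total length of order `N`; erasing them gains a
factor `exp (-2 β)` per bond, which outweighs their number. -/
theorem sum_exp_balanced_le {β : ℝ} (hβ : 9 ≤ β) (N m : ℕ) :
    ∑ x : Site N → Fin 2, (if |rowSum x| ≤ m then Real.exp (-β * isingEnergy N x) else 0)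
      ≤ Real.exp (2 * m - N) * ∑ x : Site N → Fin 2, Real.exp (-β * isingEnergy N x) := by
  set μ : (Site N → Fin 2) → ℝ := fun x => Real.exp (-2 * β * (unsat x).card) with hμ
  have hμ0 : ∀ x, 0 ≤ μ x := fun x => (Real.exp_pos _).le
  set B : ℝ := ((Finset.univ.filter fun e : Site N × Site N => IsBond e.1 e.2).card : ℝ) with hB
  have hE : ∀ x : Site N → Fin 2, Real.exp (-β * isingEnergy N x) = Real.exp (β * B) * μ x := by
    intro x
    rw [hμ, ← Real.exp_add, isingEnergy]
    congr 1
    ring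
  simp_rw [hE]
  have hpull : ∀ x : Site N → Fin 2, (if |rowSum x| ≤ m then Real.exp (β * B) * μ x else 0)
      = Real.exp (β * B) * (if |rowSum x| ≤ m then μ x else 0) := fun x => by
    split_ifs <;> simp
  simp_rw [hpull]
  rw [← Finset.mul_sum, ← Finset.mul_sum, mul_left_comm]
  refine mul_le_mul_of_nonneg_left ?_ (Real.exp_pos _).le
  set Z := ∑ x, μ x with hZ
  have hZ0 : 0 ≤ Z := Finset.sum_nonneg fun x _ => hμ0 x
  have hfiber : ∀ G ∈ clusters nearBonds (rowBonds N),
      ∑ x ∈ Finset.univ.filter (fun x => rowContours x = G), (if |rowSum x| ≤ m then μ x else 0)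
        ≤ (1 / 2) ^ (18 * G.card + (rowBonds N).card) * (Real.exp (2 * m - N) * Z) := by
    intro G _
    by_cases hex : ∃ x : Site N → Fin 2, rowContours x = G ∧ |rowSum x| ≤ m
    · obtain ⟨x₀, hx₀, hm⟩ := hex
      obtain ⟨w, hw, hshift⟩ := exists_unsat_eq_rowContours x₀
      rw [hx₀] at hw hshift
      have hsub : ∀ x : Site N → Fin 2, rowContours x = G → G ⊆ unsat x :=
        fun x hx => hx ▸ cluster_subset _
      have hrow : |rowSum w| = |rowSum x₀| := by
        refine abs_rowSum_eq_of_unsat_add fun e he hmem => ?_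
        rw [hshift x₀ (hsub x₀ hx₀), Finset.mem_sdiff] at hmem
        exact hmem.2 (hx₀ ▸ inter_subset_cluster _ (Finset.mem_inter.2 ⟨hmem.1, he⟩))
      have hiso := le_abs_rowSum_add_card_unsat w
      rw [hrow, hw] at hiso
      have hg : (N : ℝ) ≤ m + 2 * G.card := by
        have h : (N : ℤ) ≤ m + 2 * G.card := by linarith
        exact_mod_cast h
      have hterm : ∀ x ∈ Finset.univ.filter (fun x => rowContours x = G),
          (if |rowSum x| ≤ m then μ x else 0) ≤ Real.exp (-2 * β * G.card) * μ (x + w) := by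
        intro x hx
        have hxG := hsub x (Finset.mem_filter.1 hx).2
        have heq : μ x = Real.exp (-2 * β * G.card) * μ (x + w) := by
          have hcard := Finset.card_sdiff_add_card_eq_card hxG
          rw [← hshift x hxG] at hcard
          simp only [hμ]
          rw [← Real.exp_add, ← hcard]
          congr 1
          push_cast
          ring
        split_ifs
        · exact heq.le
        · exact mul_nonneg (Real.exp_pos _).le (hμ0 _)
      have htrans : ∑ x, μ (x + w) = Z := Equiv.sum_comp (Equiv.addRight w) μ
      calc _ ≤ ∑ x ∈ Finset.univ.filter (fun x => rowContours x = G),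
            Real.exp (-2 * β * G.card) * μ (x + w) := Finset.sum_le_sum hterm
        _ ≤ ∑ x, Real.exp (-2 * β * G.card) * μ (x + w) :=
            Finset.sum_le_sum_of_subset_of_nonneg (Finset.subset_univ _)
              fun x _ _ => mul_nonneg (Real.exp_pos _).le (hμ0 _)
        _ = Real.exp (-2 * β * G.card) * Z := by rw [← Finset.mul_sum, htrans]
        _ ≤ (1 / 2) ^ (18 * G.card + (rowBonds N).card) * Real.exp (2 * m - N) * Z :=
            mul_le_mul_of_nonneg_right (exp_neg_le_half_pow hβ card_rowBonds_le hg) hZ0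
        _ = _ := mul_assoc _ _ _
    · refine le_of_eq_of_le (Finset.sum_eq_zero fun x hx => if_neg fun h => ?_) (by positivity)
      exact hex ⟨x, (Finset.mem_filter.1 hx).2, h⟩
  have hmaps : ∀ x ∈ (Finset.univ : Finset (Site N → Fin 2)),
      rowContours x ∈ clusters nearBonds (rowBonds N) :=
    fun x _ => Finset.mem_image_of_mem _ (Finset.mem_univ _)
  rw [← Finset.sum_fiberwise_of_maps_to hmaps]
  refine (Finset.sum_le_sum hfiber).trans ?_
  rw [← Finset.sum_mul]
  exact mul_le_of_le_one_left (by positivity)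
    (sum_clusters_le_one self_mem_nearBonds card_nearBonds_le)

/-! ### Slow mixing -/

/-- The global spin flip. -/
def globalFlip (N : ℕ) : Equiv.Perm (Site N → Fin 2) := Equiv.addRight 1

theorem isingEnergy_globalFlip (x : Site N → Fin 2) :
    isingEnergy N (globalFlip N x) = isingEnergy N x := by
  have h : unsat (globalFlip N x) = unsat x := by
    ext e
    simp only [mem_unsat, globalFlip, Equiv.coe_addRight, Pi.add_apply, Pi.one_apply, ne_eq,
      add_left_inj]
  rw [isingEnergy, h, isingEnergy]

theorem rowSum_globalFlip (x : Site N → Fin 2) : rowSum (globalFlip N x) = -rowSum x := by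
  rw [rowSum, rowSum, ← Finset.sum_neg_distrib]
  refine Finset.sum_congr rfl fun p _ => ?_
  have h : spin (1 : Fin 2) = -1 := by decide
  simp only [globalFlip, Equiv.coe_addRight, Pi.add_apply, Pi.one_apply, spin_add, h]
  split_ifs <;> simp

/-- A lower bound on the mixing time on the `N × N` lattice. -/
theorem le_mixingTime_ising2D {β : ℝ} (hβ : 9 ≤ β) {k J : ℕ} {A : Fin J → Op (Site N)}
    (hloc : ∀ a, IsLocalOp k (A a)) (hA : ∀ a, ‖A a‖ ≤ 1) (hadj : AdjointClosed A)
    {ε : ℝ} (hε : ε ≤ 1 / 2) (hN : Real.exp (8 * k - N) ≤ 1 / 2) {T : ℕ}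
    (hT : 8 * (J * rateBound β) * Real.exp (8 * k - N) * T ≤ 1) :
    (T : ℝ≥0∞) ≤ mixingTime ε (gibbsSampler β (ising2D N) A) := by
  have hβ0 : 0 < β := by linarith
  refine le_iInf₂ fun t ht => ?_
  rw [ising2D_eq] at ht
  have hbal := sum_exp_balanced_le hβ N (4 * k)
  have h := one_le_of_halved (isingEnergy N) (s := rowSum) (κ := 2 * k) hβ0 hA hadj
    (fun a x y hxy => abs_rowSum_sub_le_of_isLocalOp (hloc a) hxy) (by positivity) (globalFlip N)
    isingEnergy_globalFlip rowSum_globalFlip hN (δ := Real.exp (8 * k - N)) (by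
      convert hbal using 3
      · push_cast
        rw [show 2 * (2 * (k : ℤ)) = 4 * k by ring]
      · push_cast
        ring) hε t.2 ht
  have h' : (T : ℝ) ≤ t := by
    set a := 8 * (J * rateBound β) * Real.exp (8 * k - N)
    have ha : 0 < a := by
      by_contra hneg
      have := mul_nonpos_of_nonpos_of_nonneg (not_lt.1 hneg) t.2
      linarith
    exact le_of_mul_le_mul_left (hT.trans h) ha
  exact_mod_cast h'

/-- The bound of `le_mixingTime_ising2D` exceeds every power of the number of sites, because the
number of jump operators grows polynomially only. -/
theorem eventually_pow_le_mixingTime_ising2D {β : ℝ} (hβ : 9 ≤ β) {k : ℕ} {J : ℕ → ℕ}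
    {A : (N : ℕ) → Fin (J N) → Op (Site N)} (hloc : ∀ N a, IsLocalOp k (A N a))
    (hA : ∀ N a, ‖A N a‖ ≤ 1) (hadj : ∀ N, AdjointClosed (A N)) {p : ℕ}
    (hJ : (fun N => (J N : ℝ)) =O[atTop] fun N => ((N ^ 2 : ℕ) : ℝ) ^ p)
    {ε : ℝ} (hε : ε ≤ 1 / 2) (d : ℕ) :
    ∀ᶠ N : ℕ in atTop,
      ((N ^ 2 : ℕ) : ℝ≥0∞) ^ d ≤ mixingTime ε (gibbsSampler β (ising2D N) (A N)) := by
  obtain ⟨C, hC⟩ := hJ.bound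
  have hexp : ∀ N : ℕ, Real.exp (8 * k - N) = Real.exp (8 * k) * Real.exp (-N) := fun N => by
    rw [← Real.exp_add, sub_eq_add_neg]
  have hlim : ∀ m : ℕ, ∀ c : ℝ, Tendsto (fun N : ℕ => c * ((N : ℝ) ^ m * Real.exp (-N))) atTop
      (nhds 0) := fun m c => by
    simpa using ((Real.tendsto_pow_mul_exp_neg_atTop_nhds_zero m).comp
      tendsto_natCast_atTop_atTop).const_mul c
  have h1 := (hlim 0 (Real.exp (8 * k))).eventually_le_const (u := 1 / 2) (by norm_num)
  have h2 := (hlim (2 * p + 2 * d) (8 * C * rateBound β * Real.exp (8 * k))).eventually_le_const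
    zero_lt_one
  filter_upwards [hC, h1, h2] with N hCN h1 h2
  rw [pow_zero, one_mul, ← hexp] at h1
  rw [Real.norm_natCast, Real.norm_of_nonneg (by positivity)] at hCN
  have hr := rateBound_nonneg β
  have hT : 8 * (J N * rateBound β) * Real.exp (8 * k - N) * ((N ^ 2) ^ d : ℕ) ≤ 1 := by
    refine le_trans ?_ h2
    calc 8 * (J N * rateBound β) * Real.exp (8 * k - N) * ((N ^ 2) ^ d : ℕ)
        ≤ 8 * (C * ((N ^ 2 : ℕ) : ℝ) ^ p * rateBound β) * Real.exp (8 * k - N)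
          * ((N ^ 2) ^ d : ℕ) := by gcongr
      _ = _ := by
        rw [hexp]
        push_cast
        ring
  exact_mod_cast le_mixingTime_ising2D hβ (hloc N) (hA N) (hadj N) hε h1 hT

end Row

end GibbsSampling

end

theorem mainTheorem8 :
    ∃ βstar : ℝ, 0 < βstar ∧ ∀ β : ℝ, βstar ≤ β →
      ∀ (k : ℕ) (J : ℕ → ℕ)
        (A : (N : ℕ) → Fin (J N) → GibbsSampling.Op (GibbsSampling.Site N)),
        (∀ N a, GibbsSampling.IsLocalOp k (A N a)) →
        (∀ N a, ‖A N a‖ ≤ 1) →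
        (∀ N, GibbsSampling.AdjointClosed (A N)) →
        (∃ p : ℕ, (fun N => (J N : ℝ)) =O[atTop] fun N => ((N ^ 2 : ℕ) : ℝ) ^ p) →
        (∀ N, GibbsSampling.gibbsSampler β (GibbsSampling.ising2D N) (A N)
          (GibbsSampling.gibbsState (GibbsSampling.ising2D N) β) = 0) ∧
        ∀ ε : ℝ, 0 < ε → ε ≤ 1 / 2 → ∀ d : ℕ, ∀ᶠ N : ℕ in atTop,
          ((N ^ 2 : ℕ) : ℝ≥0∞) ^ d ≤
            GibbsSampling.mixingTime ε
              (GibbsSampling.gibbsSampler β (GibbsSampling.ising2D N) (A N)) := by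
  refine ⟨9, by norm_num, fun β hβ k J A hloc hA hadj ⟨p, hJ⟩ => ⟨fun N => ?_, fun ε _ hε d => ?_⟩⟩
  · rw [GibbsSampling.ising2D_eq]
    exact GibbsSampling.gibbsSampler_gibbsState _ (by linarith) (hA N) (hadj N)
  · exact GibbsSampling.eventually_pow_le_mixingTime_ising2D hβ hloc hA hadj hJ hε d
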